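/- Let $N\ge 1$, let $\Omega\subset\mathbb{R}^N$ be a bounded open set (for instance a bounded domain), let $T>0$, let $p\in(1,\infty]$ and let $q\in[1,\infty)$ be its conjugate exponent, $\frac1p+\frac1q=1$. Let $u\in L^1(0,T;L^q(\Omega))$ be a time-dependent vector field with values in $\mathbb{R}^N$, let $\rho_0\in L^p(\Omega)$ and let $\rho\in L^\infty(0,T;L^p(\Omega))$ be real-valued (for $p=\infty$ this space means $L^\infty((0,T)\times\Omega)$). We say that $\rho$ is a weak solution of $\rho_t-u\cdot\nabla\rho=0$ in $(0,T)\times\Omega$, $\rho(0)=\rho_0$, if for every $\phi\in C_c^\infty([0,T)\times\Omega)$ $$-\int_0^T\int_\Omega\rho\,\phi_t\,dx\,dt-\int_\Omega\rho_0(x)\,\phi(0,x)\,dx+\int_0^T\int_\Omega\rho\,(u\cdot\nabla\phi)\,dx\,dt=0 .$$ We say that $\rho$ is a renormalized solution of the same problem if for every $\beta\in C^1(\mathbb{R})$ with $\beta$ and $\beta'$ bounded, and every $\phi\in C_c^\infty([0,T)\times\Omega)$, $$-\int_0^T\int_\Omega\beta(\rho)\,\phi_t\,dx\,dt-\int_\Omega\beta(\rho_0(x))\,\phi(0,x)\,dx+\int_0^T\int_\Omega\beta(\rho)\,(u\cdot\nabla\phi)\,dx\,dt=0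 .$$ Then: (i) if $\rho$ is a renormalized solution, then $\rho$ is a weak solution; (ii) conversely, if in addition $u\in L^1(0,T;W^{1,q}(\Omega))$ and $\nabla\cdot u=0$ weakly, that is, for almost every $t\in(0,T)$, $\int_\Omega u(t)\cdot\nabla\varphi\,dx=0$ for all $\varphi\in C_c^\infty(\Omega)$, and if $\rho$ is a weak solution, then $\rho$ is a renormalized solution. -/

import Mathlib

open MeasureTheory Set TopologicalSpace
open scoped ENNReal Distributions

noncomputable section

namespace Transport

variable {N : ℕ}

/-- Mixed Lebesgue space `L^r(0,T;L^s(Ω))`: functions that are measurable on `(0,T) × Ω` and whose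
spatial `L^s(Ω)` norm lies in `L^r(0,T)`. For `s < ∞` this is the Bochner space; for
`r = s = ∞` it is `L^∞((0,T) × Ω)`, the dual of `L^1(0,T;L^1(Ω))`. -/
def MemLrLs {F : Type*} [NormedAddCommGroup F] (Ω : Opens (EuclideanSpace ℝ (Fin N))) (T : ℝ)
    (r s : ℝ≥0∞) (f : ℝ → EuclideanSpace ℝ (Fin N) → F) : Prop :=
  AEStronglyMeasurable (Function.uncurry f)
      ((volume.restrict (Ioo 0 T)).prod (volume.restrict (Ω : Set (EuclideanSpace ℝ (Fin N))))) ∧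
    eLpNorm (fun t => eLpNorm (f t) s (volume.restrict (Ω : Set (EuclideanSpace ℝ (Fin N))))) r
      (volume.restrict (Ioo 0 T)) < ∞

/-- `G` is the weak (distributional) derivative of the vector field `v` on `Ω`: in coordinates
`∫_Ω v_i ∂_j φ = - ∫_Ω (G e_j)_i φ` for all `φ ∈ C_c^∞(Ω)`. -/
def HasWeakDerivOn (Ω : Opens (EuclideanSpace ℝ (Fin N)))
    (v : EuclideanSpace ℝ (Fin N) → EuclideanSpace ℝ (Fin N))
    (G : EuclideanSpace ℝ (Fin N) → EuclideanSpace ℝ (Fin N) →L[ℝ] EuclideanSpace ℝ (Fin N)) :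
    Prop :=
  LocallyIntegrableOn v (Ω : Set (EuclideanSpace ℝ (Fin N))) ∧
    LocallyIntegrableOn G (Ω : Set (EuclideanSpace ℝ (Fin N))) ∧
    ∀ (φ : 𝓓(Ω, ℝ)) (y : EuclideanSpace ℝ (Fin N)),
      ∫ x in (Ω : Set (EuclideanSpace ℝ (Fin N))), (fderiv ℝ φ x y) • v x =
        -∫ x in (Ω : Set (EuclideanSpace ℝ (Fin N))), φ x • G x y

/-- `u ∈ L^r(0,T;W^{1,s}(Ω))` for a time-dependent vector field `u`: both `u` and its weak spatial
derivative lie in `L^r(0,T;L^s(Ω))`. -/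
def MemLrW1s (Ω : Opens (EuclideanSpace ℝ (Fin N))) (T : ℝ) (r s : ℝ≥0∞)
    (u : ℝ → EuclideanSpace ℝ (Fin N) → EuclideanSpace ℝ (Fin N)) : Prop :=
  MemLrLs Ω T r s u ∧
    ∃ G : ℝ → EuclideanSpace ℝ (Fin N) → EuclideanSpace ℝ (Fin N) →L[ℝ] EuclideanSpace ℝ (Fin N),
      MemLrLs Ω T r s G ∧ ∀ᵐ t ∂(volume.restrict (Ioo 0 T)), HasWeakDerivOn Ω (u t) (G t)

/-- `∇ · u = 0` weakly: for almost every `t ∈ (0,T)`, `∫_Ω u(t) · ∇φ = 0` for all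
`φ ∈ C_c^∞(Ω)`. -/
def IsDivFree (Ω : Opens (EuclideanSpace ℝ (Fin N))) (T : ℝ)
    (u : ℝ → EuclideanSpace ℝ (Fin N) → EuclideanSpace ℝ (Fin N)) : Prop :=
  ∀ᵐ t ∂(volume.restrict (Ioo 0 T)), ∀ φ : 𝓓(Ω, ℝ),
    ∫ x in (Ω : Set (EuclideanSpace ℝ (Fin N))), inner ℝ (u t x) (gradient φ x) = 0

/-- The open set `(-∞,T) × Ω`. The restrictions to `[0,T) × Ω` of the test functions on it are the
smooth functions with compact support in `[0,T) × Ω`. -/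
def spaceTime (Ω : Opens (EuclideanSpace ℝ (Fin N))) (T : ℝ) :
    Opens (ℝ × EuclideanSpace ℝ (Fin N)) :=
  ⟨Iio T ×ˢ (Ω : Set (EuclideanSpace ℝ (Fin N))), isOpen_Iio.prod Ω.isOpen⟩

/-- The left-hand side of the weak formulation of `ρ_t - u · ∇ρ = 0`, `ρ(0) = ρ₀`:
`-∫_0^T ∫_Ω ρ φ_t dx dt - ∫_Ω ρ₀ φ(0,·) dx + ∫_0^T ∫_Ω ρ (u · ∇φ) dx dt`. -/
def weakForm (Ω : Opens (EuclideanSpace ℝ (Fin N))) (T : ℝ)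
    (u : ℝ → EuclideanSpace ℝ (Fin N) → EuclideanSpace ℝ (Fin N))
    (ρ₀ : EuclideanSpace ℝ (Fin N) → ℝ) (ρ : ℝ → EuclideanSpace ℝ (Fin N) → ℝ)
    (φ : ℝ × EuclideanSpace ℝ (Fin N) → ℝ) : ℝ :=
  -(∫ t in Ioo 0 T, ∫ x in (Ω : Set (EuclideanSpace ℝ (Fin N))),
      ρ t x * deriv (fun s => φ (s, x)) t)
    - (∫ x in (Ω : Set (EuclideanSpace ℝ (Fin N))), ρ₀ x * φ (0, x))
    + ∫ t in Ioo 0 T, ∫ x in (Ω : Set (EuclideanSpace ℝ (Fin N))),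
      ρ t x * inner ℝ (u t x) (gradient (fun y => φ (t, y)) x)

/-- `ρ ∈ L^∞(0,T;L^p(Ω))` is a weak solution of the transport equation with velocity field `u` and
initial density `ρ₀ ∈ L^p(Ω)`. -/
def IsWeakSolution (Ω : Opens (EuclideanSpace ℝ (Fin N))) (T : ℝ) (p : ℝ≥0∞)
    (u : ℝ → EuclideanSpace ℝ (Fin N) → EuclideanSpace ℝ (Fin N))
    (ρ₀ : EuclideanSpace ℝ (Fin N) → ℝ) (ρ : ℝ → EuclideanSpace ℝ (Fin N) → ℝ) : Prop :=
  MemLp ρ₀ p (volume.restrict (Ω : Set (EuclideanSpace ℝ (Fin N)))) ∧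
    MemLrLs Ω T ∞ p ρ ∧
    ∀ φ : 𝓓(spaceTime Ω T, ℝ), weakForm Ω T u ρ₀ ρ φ = 0

/-- Admissible functions: `β ∈ C^1(ℝ)` with `β` and `β'` bounded. -/
def IsAdmissible (β : ℝ → ℝ) : Prop :=
  ContDiff ℝ 1 β ∧ (∃ C, ∀ s, |β s| ≤ C) ∧ ∃ C, ∀ s, |deriv β s| ≤ C

/-- `ρ ∈ L^∞(0,T;L^p(Ω))` is a renormalized solution of the transport equation with velocity field
`u` and initial density `ρ₀ ∈ L^p(Ω)`. -/
def IsRenormalizedSolution (Ω : Opens (EuclideanSpace ℝ (Fin N))) (T : ℝ) (p : ℝ≥0∞)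
    (u : ℝ → EuclideanSpace ℝ (Fin N) → EuclideanSpace ℝ (Fin N))
    (ρ₀ : EuclideanSpace ℝ (Fin N) → ℝ) (ρ : ℝ → EuclideanSpace ℝ (Fin N) → ℝ) : Prop :=
  MemLp ρ₀ p (volume.restrict (Ω : Set (EuclideanSpace ℝ (Fin N)))) ∧
    MemLrLs Ω T ∞ p ρ ∧
    ∀ β : ℝ → ℝ, IsAdmissible β → ∀ φ : 𝓓(spaceTime Ω T, ℝ),
      weakForm Ω T u (fun x => β (ρ₀ x)) (fun t x => β (ρ t x)) φ = 0

end Transport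

end

/-! From renormalized to weak: the functions `(k+1) * arctan (s/(k+1))` are admissible, are bounded
by `|s|` and tend to `s`. Since `ρ` and `ρ u` are integrable on the bounded cylinder (Hölder),
dominated convergence passes to the limit in the weak form.

From weak to renormalized, the argument is the DiPerna–Lions regularization. Write `ρ_ε` for the
mollification of `ρ` in space. Testing the equation with products of a function of time and a
translated kernel gives, at each point at distance more than `ε` from the boundary, `∂_t ρ_ε -
u·∇ρ_ε = r_ε`, where `r_ε(x) = ∫ ρ(y) ∇η_ε(x-y)·(u(y)-u(x)) dy`. For smooth `β` the chain rule is
legitimate: in time because `ρ_ε(·,x)` agrees a.e. with an absolutely continuous function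
(`weak_chain_rule`), in space because `φ β(ρ_ε)` is a smooth test function for `∇·u = 0`
(`integral_renormalized_flux`). Hence the weak form of `β(ρ_ε)` equals `∫∫ φ β'(ρ_ε) r_ε`
(`globalForm_mollify`).

The heart is `r_ε → 0` in `L^1` near the support of `φ` (`lintegral_commutator_le`). With `G` the
weak derivative of `u`, the difference `u(x-w) - u(x)` is `-∫_0^1 G(x-sw) w ds`. Replacing `ρ(x-w)
G(x-sw)` by `ρ(x) G(x)` turns the commutator into `-ρ(x) ∫ ∇η_ε(w)·G(x)w dw = ρ(x) tr G(x) = 0`. The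
error is weighted by `|w| |∇η_ε(w)|`, whose integral does not depend on `ε`, and is measured by the
`L^1` distance between `ρ G` and products of small independent translates. That distance tends to
zero by Hölder and continuity of translations in `L^q` and in `L^1`; no translation continuity of
`ρ` in `L^p` is needed, so `p = ∞` is included. In time, the bounds are dominated by a multiple of
`‖G(t)‖_q`.

The same translation estimate gives `β(ρ_ε) → β(ρ)` in the remaining terms. A general `β ∈ C^1` is
reached by mollifying `β` itself and applying dominated convergence once more. -/

namespace Transport

open Filter Topology Metric
open scoped ContDiff

/-! ### Continuity of translations for products of `L^p` and `L^q` functions. -/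

section Translation

variable {E F : Type*} [NormedAddCommGroup E] [InnerProductSpace ℝ E] [FiniteDimensional ℝ E]
  [MeasurableSpace E] [BorelSpace E] [NormedAddCommGroup F]

/-- Translations act continuously on `L^q` for `q < ∞`. -/
theorem tendsto_eLpNorm_translate_sub {g : E → F} {q : ℝ≥0∞} (hq1 : 1 ≤ q) (hq : q ≠ ⊤)
    (hg : MemLp g q volume) :
    Tendsto (fun a : E => eLpNorm (fun x => g (x - a) - g x) q volume) (𝓝 0) (𝓝 0) := by
  have : Fact (1 ≤ q) := ⟨hq1⟩
  -- Currying makes the translation depend continuously on `a` in the compact-open topology, the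
  -- sense in which composition acts continuously on `L^q`.
  let τ : C(E, C(E, E)) := ContinuousMap.curry ⟨fun z : E × E => z.2 - z.1, by fun_prop⟩
  have hmp : ∀ a, MeasurePreserving (τ a) (volume : Measure E) volume :=
    fun a => measurePreserving_sub_right volume a
  have h := Filter.Tendsto.compMeasurePreservingLp (l := 𝓝 (0 : E)) (f := fun _ => hg.toLp g)
    (g := τ) tendsto_const_nhds (τ.continuous.tendsto 0) hmp (hmp 0) hq
  rw [tendsto_iff_edist_tendsto_0] at h
  refine h.congr fun a => ?_
  rw [Lp.toLp_compMeasurePreserving, Lp.toLp_compMeasurePreserving, Lp.edist_toLp_toLp]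
  congr 1
  ext x
  simp [τ]

theorem eLpNorm_comp_sub_right (f : E → F) {p : ℝ≥0∞} (hf : AEStronglyMeasurable f volume)
    (a : E) : eLpNorm (fun x => f (x - a)) p volume = eLpNorm f p volume :=
  eLpNorm_comp_measurePreserving hf (measurePreserving_sub_right volume a)

theorem aestronglyMeasurable_comp_sub_right {f : E → F} (hf : AEStronglyMeasurable f volume)
    (a : E) : AEStronglyMeasurable (fun x => f (x - a)) volume :=
  hf.comp_measurePreserving (measurePreserving_sub_right volume a)

variable [NormedSpace ℝ F]

/-- Triangle inequality, Hölder and translation invariance. The bound is uniform in the shifts and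
serves as the majorant in time for dominated convergence. -/
theorem lintegral_enorm_translate_smul_sub_le {p q : ℝ≥0∞} (hpq : p⁻¹ + q⁻¹ = 1)
    {f : E → ℝ} {g : E → F} (hf : AEStronglyMeasurable f volume)
    (hg : AEStronglyMeasurable g volume) (a b : E) :
    ∫⁻ x, ‖f (x - a) • g (x - b) - f x • g x‖ₑ ≤
      2 * (eLpNorm f p volume * eLpNorm g q volume) := by
  have : ENNReal.HolderConjugate p q := ENNReal.holderConjugate_iff.2 hpq
  have hfa := aestronglyMeasurable_comp_sub_right hf a
  have hgb := aestronglyMeasurable_comp_sub_right hg b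
  rw [← eLpNorm_one_eq_lintegral_enorm]
  refine (eLpNorm_sub_le (f := fun x => f (x - a) • g (x - b)) (g := fun x => f x • g x)
    (hfa.smul hgb) (hf.smul hg) le_rfl).trans ?_
  rw [two_mul]
  refine add_le_add ?_ (eLpNorm_smul_le_mul_eLpNorm (p := p) (q := q) hg hf)
  refine (eLpNorm_smul_le_mul_eLpNorm (p := p) (q := q) hgb hfa).trans ?_
  rw [eLpNorm_comp_sub_right f hf, eLpNorm_comp_sub_right g hg]

/-- For `f ∈ L^p` and `g ∈ L^q` with conjugate exponents and `q < ∞`, the product of independent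
small translates of `f` and `g` is close to `f g` in `L^1`. -/
theorem exists_forall_lintegral_enorm_translate_smul_sub_le {p q : ℝ≥0∞}
    (hpq : p⁻¹ + q⁻¹ = 1) (hq : q ≠ ⊤) {f : E → ℝ} {g : E → F} (hf : MemLp f p volume)
    (hg : MemLp g q volume) {δ : ℝ≥0∞} (hδ : 0 < δ) :
    ∃ r > 0, ∀ a b : E, ‖a‖ ≤ r → ‖b‖ ≤ r →
      ∫⁻ x, ‖f (x - a) • g (x - b) - f x • g x‖ₑ ≤ δ := by
  have : ENNReal.HolderConjugate p q := ENNReal.holderConjugate_iff.2 hpq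
  have hq1 : 1 ≤ q := by
    rw [← ENNReal.inv_le_one, ← hpq]; exact le_add_self
  have hfg : MemLp (fun x => f x • g x) 1 volume := hg.smul hf
  have h1 := tendsto_eLpNorm_translate_sub le_rfl ENNReal.one_ne_top hfg
  have h2 : Tendsto (fun c : E => eLpNorm f p volume *
      eLpNorm (fun x => g (x - c) - g x) q volume) (𝓝 0) (𝓝 0) := by
    have := ENNReal.Tendsto.const_mul (tendsto_eLpNorm_translate_sub hq1 hq hg)
      (Or.inr hf.eLpNorm_ne_top)
    simpa using this
  have hδ2 : 0 < δ / 2 := ENNReal.div_pos hδ.ne' (by simp)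
  obtain ⟨r1, hr1, h1⟩ := Metric.eventually_nhds_iff.1 (h1.eventually (ge_mem_nhds hδ2))
  obtain ⟨r2, hr2, h2⟩ := Metric.eventually_nhds_iff.1 (h2.eventually (ge_mem_nhds hδ2))
  refine ⟨min (r1 / 2) (r2 / 4), by positivity, fun a b ha hb => ?_⟩
  have ha1 := h1 (y := a) (by
    rw [dist_zero_right]; have := ha.trans (min_le_left _ _); linarith)
  have hab := h2 (y := b - a) (by
    rw [dist_zero_right]
    have h3 := ha.trans (min_le_right _ _)
    have h4 := hb.trans (min_le_right _ _)
    have := norm_sub_le b a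
    linarith)
  have hfa := aestronglyMeasurable_comp_sub_right hf.1 a
  have hga := aestronglyMeasurable_comp_sub_right hg.1 a
  have hgb := aestronglyMeasurable_comp_sub_right hg.1 b
  -- Inserting `f (x - a) • g (x - a)` leaves a difference of translates of `g` alone and a
  -- translate of the single `L^1` function `f g`. The modulus of continuity of `f` in `L^p` never
  -- enters.
  have hsplit : (fun x => f (x - a) • g (x - b) - f x • g x) =
      (fun x => f (x - a) • (g (x - b) - g (x - a))) +
        fun x => f (x - a) • g (x - a) - f x • g x := by
    ext x
    simp [smul_sub]
  rw [← eLpNorm_one_eq_lintegral_enorm, hsplit]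
  refine (eLpNorm_add_le (hfa.smul (hgb.sub hga)) ((hfa.smul hga).sub (hf.1.smul hg.1))
    le_rfl).trans ?_
  rw [← ENNReal.add_halves δ]
  refine add_le_add ?_ ha1
  refine (eLpNorm_smul_le_mul_eLpNorm (p := p) (q := q) (hgb.sub hga) hfa).trans ?_
  rw [eLpNorm_comp_sub_right f hf.1]
  refine le_trans (le_of_eq ?_) hab
  congr 1
  rw [← eLpNorm_comp_sub_right (fun x => g (x - (b - a)) - g x)
    ((aestronglyMeasurable_comp_sub_right hg.1 _).sub hg.1) a]
  congr 1
  ext x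
  simp only [Pi.sub_apply]
  congr 2
  abel

end Translation

/-! ### Weak derivatives: difference quotients, trace, and integration by parts. -/

section WeakDerivative

variable {E F : Type*} [NormedAddCommGroup E] [InnerProductSpace ℝ E] [FiniteDimensional ℝ E]
  [MeasurableSpace E] [BorelSpace E] [NormedAddCommGroup F]

/-- Every slice in the parameter is a translate of `g` with the same `L^1` norm, so the finiteness
of `μ` suffices. It justifies the Fubini exchanges along segments. -/
theorem integrable_comp_add_smul_prod {g : E → F} (hgm : StronglyMeasurable g)
    (hg : Integrable g volume) (h : E) (μ : Measure ℝ) [IsFiniteMeasure μ] :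
    Integrable (fun z : E × ℝ => g (z.1 + z.2 • h)) (volume.prod μ) := by
  have hm : StronglyMeasurable (fun z : E × ℝ => g (z.1 + z.2 • h)) :=
    hgm.comp_measurable (by fun_prop)
  rw [integrable_prod_iff' hm.aestronglyMeasurable]
  refine ⟨Eventually.of_forall fun s => hg.comp_add_right (s • h), ?_⟩
  have : ∀ s : ℝ, ∫ x, ‖g (x + s • h)‖ = ∫ x, ‖g x‖ := fun s =>
    integral_add_right_eq_self (fun x => ‖g x‖) (s • h)
  simp only [this]
  exact integrable_const _

variable [NormedSpace ℝ F]

omit [FiniteDimensional ℝ E] [MeasurableSpace E] [BorelSpace E] in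
theorem integral_fderiv_comp_sub_smul {φ : E → ℝ} (hφ : ContDiff ℝ ∞ φ) (x h : E) :
    ∫ s in (0 : ℝ)..1, fderiv ℝ φ (x - s • h) h = φ x - φ (x - h) := by
  have hd : ∀ s : ℝ, HasDerivAt (fun s : ℝ => -φ (x - s • h)) (fderiv ℝ φ (x - s • h) h) s := by
    intro s
    have h1 : HasDerivAt (fun s : ℝ => x - s • h) (-h) s := by
      simpa using ((hasDerivAt_id s).smul_const h).const_sub x
    have h2 := ((hφ.differentiable (by simp)) (x - s • h)).hasFDerivAt.comp_hasDerivAt s h1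
    simpa [Function.comp_def] using h2.fun_neg
  rw [intervalIntegral.integral_eq_sub_of_hasDerivAt (fun s _ => hd s)]
  · simp; ring
  · refine Continuous.intervalIntegrable ?_ _ _
    have := hφ.continuous_fderiv (by simp)
    fun_prop

/-- A function with an integrable weak derivative is, up to null sets, the integral of that
derivative along segments. -/
theorem ae_sub_eq_integral_of_weakDeriv [CompleteSpace F] {Ω U : Set E} (hU : IsOpen U)
    {v : E → F} {G : E → E →L[ℝ] F} (hv : Integrable v volume) (hGm : StronglyMeasurable G)
    (hG : Integrable G volume)
    (hw : ∀ φ : E → ℝ, ContDiff ℝ ∞ φ → HasCompactSupport φ → tsupport φ ⊆ Ω → ∀ y,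
      ∫ x, fderiv ℝ φ x y • v x = -∫ x, φ x • G x y)
    (h : E) (hUh : ∀ x ∈ U, ∀ s ∈ Icc (0 : ℝ) 1, x + s • h ∈ Ω) :
    ∀ᵐ x, x ∈ U → v (x + h) - v x = ∫ s in (0 : ℝ)..1, G (x + s • h) h := by
  set μ : Measure ℝ := volume.restrict (Ioc 0 1) with hμ
  have hGh : Integrable (fun x => G x h) volume := hG.apply_continuousLinearMap h
  have hGhm : StronglyMeasurable (fun x => G x h) := 
    (ContinuousLinearMap.apply ℝ F h).continuous.comp_stronglyMeasurable hGm
  have hH := integrable_comp_add_smul_prod hGhm hGh h μ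
  have hI : Integrable (fun x => ∫ s in (0 : ℝ)..1, G (x + s • h) h) volume := by
    simpa only [intervalIntegral.integral_of_le zero_le_one] using hH.integral_prod_left
  have hvh : Integrable (fun x => v (x + h)) volume := hv.comp_add_right h
  have key := hU.ae_eq_zero_of_integral_contDiff_smul_eq_zero (μ := volume)
    (f := fun x => v (x + h) - v x - ∫ s in (0 : ℝ)..1, G (x + s • h) h)
    (((hvh.sub hv).sub hI).locallyIntegrable.locallyIntegrableOn U) ?_
  · filter_upwards [key] with x hx hxU
    exact sub_eq_zero.1 (hx hxU)
  intro g hg hgc hgU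
  obtain ⟨C, hC⟩ := hgc.exists_bound_of_continuous hg.continuous
  have hg1 := hg.continuous_fderiv (by simp)
  obtain ⟨C', hC'⟩ := (hgc.fderiv ℝ).exists_bound_of_continuous hg1
  have hgsm : ∀ {w : E → F}, Integrable w volume → Integrable (fun x => g x • w x) volume :=
    fun hw => hw.bdd_smul C hg.continuous.aestronglyMeasurable (Eventually.of_forall hC)
  have hgsh : Integrable (fun x => g (x - h) • v x) volume :=
    hv.bdd_smul C (by fun_prop) (Eventually.of_forall fun x => hC _)
  have e1 : ∫ x, g x • v (x + h) = ∫ x, g (x - h) • v x := by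
    rw [← integral_sub_right_eq_self (fun x => g x • v (x + h)) h]
    simp
  -- Moving the shift onto the test function turns `g` into `g (· - s • h)`. Its support stays in
  -- `Ω` because the segments starting in `U` do, so the weak derivative may be tested with it.
  have hslice : ∀ s ∈ Ioc (0 : ℝ) 1, ∫ x, g x • G (x + s • h) h =
      -∫ x, fderiv ℝ g (x - s • h) h • v x := by
    intro s hs
    have := hw (fun x => g (x - s • h)) (by fun_prop)
      (hgc.comp_homeomorph (Homeomorph.subRight (s • h))) ?_ h
    · simp only [fderiv_comp_sub] at this
      rw [this, neg_neg, ← integral_sub_right_eq_self (fun x => g x • G (x + s • h) h) (s • h)]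
      simp
    · intro x hx
      have hx' : x - s • h ∈ tsupport g := by
        have := tsupport_comp_eq_preimage g (Homeomorph.subRight (s • h))
        exact (this ▸ hx : x ∈ (Homeomorph.subRight (s • h)) ⁻¹' tsupport g)
      have := hUh _ (hgU hx') s ⟨hs.1.le, hs.2⟩
      simpa using this
  have hprod1 : Integrable (fun z : E × ℝ => g z.1 • G (z.1 + z.2 • h) h) (volume.prod μ) :=
    hH.bdd_smul C (by fun_prop) (Eventually.of_forall fun z => hC _)
  have hprod2 : Integrable (fun z : E × ℝ => fderiv ℝ g (z.1 - z.2 • h) h • v z.1)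
      (volume.prod μ) := by
    refine (hv.comp_fst μ).bdd_smul (C' * ‖h‖) (by fun_prop) (Eventually.of_forall fun z => ?_)
    exact (ContinuousLinearMap.le_opNorm _ _).trans (by gcongr; exact hC' _)
  have e2 : ∫ x, g x • ∫ s in (0 : ℝ)..1, G (x + s • h) h =
      ∫ x, (g (x - h) - g x) • v x := by
    calc ∫ x, g x • ∫ s in (0 : ℝ)..1, G (x + s • h) h
        = ∫ x, ∫ s, g x • G (x + s • h) h ∂μ := by
          refine integral_congr_ae (Eventually.of_forall fun x => ?_)
          simp only [intervalIntegral.integral_of_le zero_le_one, hμ, integral_smul]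
      _ = ∫ s, (∫ x, g x • G (x + s • h) h) ∂μ := integral_integral_swap hprod1
      _ = ∫ s, (-∫ x, fderiv ℝ g (x - s • h) h • v x) ∂μ :=
          setIntegral_congr_fun measurableSet_Ioc hslice
      _ = -∫ x, ∫ s, fderiv ℝ g (x - s • h) h • v x ∂μ := by
          rw [integral_neg]
          exact congrArg Neg.neg (integral_integral_swap hprod2).symm
      _ = ∫ x, (g (x - h) - g x) • v x := by
          rw [← integral_neg]
          refine integral_congr_ae (Eventually.of_forall fun x => ?_)
          simp only [hμ, ← intervalIntegral.integral_of_le zero_le_one]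
          rw [intervalIntegral.integral_smul_const, integral_fderiv_comp_sub_smul hg, ← neg_smul, neg_sub]
  simp only [smul_sub]
  have e3 := integral_sub ((hgsm hvh).sub (hgsm hv)) (hgsm hI)
  simp only [Pi.sub_apply] at e3
  rw [e3, integral_sub (hgsm hvh) (hgsm hv), e1, e2]
  simp only [sub_smul]
  rw [integral_sub hgsh (hgsm hv), sub_self]

/-- The trace of the weak derivative of a weakly divergence free field vanishes. -/
theorem ae_sum_inner_eq_zero_of_divFree {ι : Type*} [Fintype ι] (b : OrthonormalBasis ι ℝ E)
    {Ω : Set E} (hΩ : IsOpen Ω) {v : E → E} {G : E → E →L[ℝ] E} (hv : Integrable v volume)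
    (hG : Integrable G volume)
    (hw : ∀ φ : E → ℝ, ContDiff ℝ ∞ φ → HasCompactSupport φ → tsupport φ ⊆ Ω → ∀ y,
      ∫ x, fderiv ℝ φ x y • v x = -∫ x, φ x • G x y)
    (hdiv : ∀ φ : E → ℝ, ContDiff ℝ ∞ φ → HasCompactSupport φ → tsupport φ ⊆ Ω →
      ∫ x, fderiv ℝ φ x (v x) = 0) :
    ∀ᵐ x, x ∈ Ω → ∑ i, inner ℝ (b i) (G x (b i)) = 0 := by
  have hGi : ∀ i, Integrable (fun x => G x (b i)) volume :=
    fun i => hG.apply_continuousLinearMap (b i)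
  have hGii : ∀ i, Integrable (fun x => inner ℝ (b i) (G x (b i))) volume :=
    fun i => (hGi i).const_inner (b i)
  refine hΩ.ae_eq_zero_of_integral_contDiff_smul_eq_zero
    ((integrable_finsetSum _ fun i _ => hGii i).locallyIntegrable.locallyIntegrableOn Ω) ?_
  intro φ hφ hφc hφΩ
  obtain ⟨C, hC⟩ := hφc.exists_bound_of_continuous hφ.continuous
  have hφ1 := hφ.continuous_fderiv (by simp)
  obtain ⟨C', hC'⟩ := (hφc.fderiv ℝ).exists_bound_of_continuous hφ1
  have h1 : ∀ i, Integrable (fun x => fderiv ℝ φ x (b i) • v x) volume := fun i => by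
    refine hv.bdd_smul (C' * ‖b i‖) (by fun_prop) (Eventually.of_forall fun z => ?_)
    exact (ContinuousLinearMap.le_opNorm _ _).trans (by gcongr; exact hC' _)
  have h2 : ∀ i, Integrable (fun x => φ x • G x (b i)) volume := fun i =>
    (hGi i).bdd_smul C hφ.continuous.aestronglyMeasurable (Eventually.of_forall hC)
  have h3 : ∀ x, fderiv ℝ φ x (v x) = ∑ i, inner ℝ (b i) (fderiv ℝ φ x (b i) • v x) := by
    intro x
    conv_lhs => rw [← b.sum_repr' (v x)]
    simp [map_sum, inner_smul_right, mul_comm]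
  have h4 := hdiv φ hφ hφc hφΩ
  simp only [h3] at h4
  rw [integral_finsetSum _ fun i _ => (h1 i).const_inner (b i)] at h4
  simp only [integral_inner (h1 _), hw φ hφ hφc hφΩ, inner_neg_right, Finset.sum_neg_distrib,
    neg_eq_zero] at h4
  simp only [← integral_inner (h2 _)] at h4
  rw [← integral_finsetSum _ fun i _ => (h2 i).const_inner (b i)] at h4
  rw [← h4]
  refine integral_congr_ae (Eventually.of_forall fun x => ?_)
  simp [inner_smul_right, Finset.mul_sum]

/-- Integration by parts: the linear field `w ↦ A w` has constant divergence `tr A`. For a trace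
free `A` the integral vanishes, which is the cancellation used in the commutator. -/
theorem integral_fderiv_apply_linear {ι : Type*} [Fintype ι] (b : OrthonormalBasis ι ℝ E)
    {η : E → ℝ} (hη : ContDiff ℝ ∞ η) (hηc : HasCompactSupport η) (A : E →L[ℝ] E) :
    ∫ w, fderiv ℝ η w (A w) = -((∑ i, inner ℝ (b i) (A (b i))) * ∫ w, η w) := by
  have hη1 := hη.continuous_fderiv (by simp)
  have hcs : ∀ c : E, HasCompactSupport fun w => fderiv ℝ η w c := fun c =>
    (hηc.fderiv ℝ).comp_left (g := fun l : E →L[ℝ] ℝ => l c) (by simp)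
  have hint : ∀ i, Integrable (fun w => inner ℝ (b i) w * fderiv ℝ η w (A (b i))) volume :=
    fun i => Continuous.integrable_of_hasCompactSupport (by fun_prop) (hcs _).mul_left
  have h3 : ∀ w, fderiv ℝ η w (A w) = ∑ i, inner ℝ (b i) w * fderiv ℝ η w (A (b i)) := by
    intro w
    conv_lhs => rw [← b.sum_repr' w, map_sum, map_sum, b.sum_repr' w]
    simp
  simp only [h3]
  rw [integral_finsetSum _ fun i _ => hint i, Finset.sum_mul, ← Finset.sum_neg_distrib]
  refine Finset.sum_congr rfl fun i _ => ?_
  have hf : ∀ w, fderiv ℝ (fun w => inner ℝ (b i) w) w (A (b i)) = inner ℝ (b i) (A (b i)) := by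
    intro w
    exact congrArg (fun l : E →L[ℝ] ℝ => l (A (b i))) (innerSL ℝ (b i)).fderiv
  have hηi : Integrable η volume := hη.continuous.integrable_of_hasCompactSupport hηc
  rw [integral_mul_fderiv_eq_neg_fderiv_mul_of_integrable]
  · simp only [hf, integral_const_mul]
  · simp only [hf]; exact hηi.const_mul _
  · exact hint i
  · exact Continuous.integrable_of_hasCompactSupport (by have := hη.continuous; fun_prop) hηc.mul_left
  · exact fun x _ => (innerSL ℝ (b i)).differentiableAt
  · exact fun x _ => hη.differentiable (by simp) x

end WeakDerivative

/-! ### Mollifiers with a scale-invariant gradient moment. -/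

section Mollifier

variable {E F : Type*} [NormedAddCommGroup E] [InnerProductSpace ℝ E] [FiniteDimensional ℝ E]
  [MeasurableSpace E] [BorelSpace E] [NormedAddCommGroup F] [NormedSpace ℝ F]

/-- A smooth nonnegative kernel of mass one supported in the closed ball of radius `δ`, whose
gradient has first absolute moment at most `C`. -/
structure IsMollifier (η : E → ℝ) (δ : ℝ) (C : ℝ≥0∞) : Prop where
  contDiff : ContDiff ℝ ∞ η
  tsupport_subset : tsupport η ⊆ closedBall 0 δ
  integral_eq_one : ∫ w, η w = 1
  nonneg : ∀ w, 0 ≤ η w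
  moment_le : ∫⁻ w, ‖w‖ₑ * ‖fderiv ℝ η w‖ₑ ≤ C

namespace IsMollifier

variable {η : E → ℝ} {δ : ℝ} {C : ℝ≥0∞}

theorem hasCompactSupport (hη : IsMollifier η δ C) : HasCompactSupport η :=
  (isCompact_closedBall (0 : E) δ).of_isClosed_subset (isClosed_tsupport η) hη.tsupport_subset

theorem continuous (hη : IsMollifier η δ C) : Continuous η := hη.contDiff.continuous

theorem continuous_fderiv (hη : IsMollifier η δ C) : Continuous (fderiv ℝ η) :=
  hη.contDiff.continuous_fderiv (by simp)

theorem integrable (hη : IsMollifier η δ C) : Integrable η volume :=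
  hη.continuous.integrable_of_hasCompactSupport hη.hasCompactSupport

theorem eq_zero (hη : IsMollifier η δ C) {w : E} (hw : δ < ‖w‖) : η w = 0 :=
  image_eq_zero_of_notMem_tsupport fun h => by
    have := hη.tsupport_subset h
    rw [mem_closedBall_zero_iff] at this
    exact this.not_gt hw

theorem fderiv_eq_zero (hη : IsMollifier η δ C) {w : E} (hw : δ < ‖w‖) : fderiv ℝ η w = 0 := by
  have : w ∉ tsupport (fderiv ℝ η) := fun h => by
    have := hη.tsupport_subset (tsupport_fderiv_subset ℝ h)
    rw [mem_closedBall_zero_iff] at this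
    exact this.not_gt hw
  exact image_eq_zero_of_notMem_tsupport this

theorem exists_bound (hη : IsMollifier η δ C) :
    ∃ B : ℝ, (∀ w, ‖η w‖ ≤ B) ∧ ∀ w, ‖fderiv ℝ η w‖ ≤ B := by
  obtain ⟨B₁, h₁⟩ := hη.hasCompactSupport.exists_bound_of_continuous hη.continuous
  obtain ⟨B₂, h₂⟩ := (hη.hasCompactSupport.fderiv ℝ).exists_bound_of_continuous
    hη.continuous_fderiv
  exact ⟨max B₁ B₂, fun w => (h₁ w).trans (le_max_left _ _),
    fun w => (h₂ w).trans (le_max_right _ _)⟩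

theorem lintegral_eq_one (hη : IsMollifier η δ C) : ∫⁻ w, ‖η w‖ₑ = 1 := by
  have h := ofReal_integral_eq_lintegral_ofReal hη.integrable (Eventually.of_forall hη.nonneg)
  rw [hη.integral_eq_one, ENNReal.ofReal_one] at h
  rw [h]
  exact lintegral_congr fun w => Real.enorm_eq_ofReal (hη.nonneg w)

end IsMollifier

theorem lintegral_comp_smul_addHaar {c : ℝ} (hc : c ≠ 0) {g : E → ℝ≥0∞} (hg : Measurable g) :
    ∫⁻ w, g (c • w) = ENNReal.ofReal |(c ^ Module.finrank ℝ E)⁻¹| * ∫⁻ w, g w := by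
  rw [← lintegral_map hg (measurable_const_smul c), Measure.map_addHaar_smul _ hc,
    lintegral_smul_measure, smul_eq_mul]

-- The bound `C` is chosen before `δ`: rescaling a bump to radius `δ` multiplies the gradient by
-- `δ⁻¹` and lengths by `δ`, so the first moment of the gradient is unchanged.
variable (E) in
theorem exists_isMollifier :
    ∃ C : ℝ≥0∞, C ≠ ⊤ ∧ ∀ δ : ℝ, 0 < δ → ∃ η : E → ℝ, IsMollifier η δ C := by
  let ζ : ContDiffBump (0 : E) := ⟨1 / 2, 1, by norm_num, by norm_num⟩
  set η₀ : E → ℝ := ζ.normed volume with hη₀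
  have hs : ContDiff ℝ ∞ η₀ := ζ.contDiff_normed
  have hc : HasCompactSupport η₀ := ζ.hasCompactSupport_normed
  have hd : Continuous (fderiv ℝ η₀) := hs.continuous_fderiv (by simp)
  refine ⟨∫⁻ w : E, ‖w‖ₑ * ‖fderiv ℝ η₀ w‖ₑ, ?_, fun δ hδ => ?_⟩
  · have : Integrable (fun w : E => ‖w‖ * ‖fderiv ℝ η₀ w‖) volume :=
      Continuous.integrable_of_hasCompactSupport (by fun_prop) (hc.fderiv ℝ).norm.mul_left
    have h := this.2
    simp only [HasFiniteIntegral, enorm_mul, enorm_norm] at h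
    exact h.ne
  set d := Module.finrank ℝ E
  have hδd : 0 < δ ^ d := by positivity
  have hfd : ∀ w, fderiv ℝ (fun w => (δ ^ d)⁻¹ * η₀ (δ⁻¹ • w)) w =
      (δ ^ d)⁻¹ • δ⁻¹ • fderiv ℝ η₀ (δ⁻¹ • w) := by
    intro w
    rw [fderiv_const_mul]
    · rw [fderiv_comp_smul]
    · exact (hs.differentiable (by simp)).differentiableAt.comp _ (by fun_prop)
  refine ⟨fun w => (δ ^ d)⁻¹ * η₀ (δ⁻¹ • w), ⟨by fun_prop, ?_, ?_, ?_, ?_⟩⟩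
  · refine closure_minimal (fun w hw => ?_) isClosed_closedBall
    have hw' : δ⁻¹ • w ∈ Function.support η₀ := fun h => hw (by simp [h])
    rw [ζ.support_normed_eq, mem_ball_zero_iff, norm_smul, norm_inv, Real.norm_of_nonneg hδ.le]
      at hw'
    rw [mem_closedBall_zero_iff]
    change δ⁻¹ * ‖w‖ < 1 at hw'
    rw [inv_mul_lt_iff₀ hδ, mul_one] at hw'
    exact hw'.le
  · rw [integral_const_mul, Measure.integral_comp_inv_smul, ζ.integral_normed, abs_of_pos hδd]
    simp [d, hδd.ne']
  · exact fun w => mul_nonneg (by positivity) (ζ.nonneg_normed _)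
  · refine le_of_eq ?_
    have e1 : ∀ w : E, ‖w‖ₑ * ‖fderiv ℝ (fun w => (δ ^ d)⁻¹ * η₀ (δ⁻¹ • w)) w‖ₑ =
        ‖(δ ^ d)⁻¹‖ₑ * (‖δ⁻¹ • w‖ₑ * ‖fderiv ℝ η₀ (δ⁻¹ • w)‖ₑ) := by
      intro w
      rw [hfd]
      simp only [enorm_smul]
      ring
    simp only [e1]
    rw [lintegral_const_mul' _ _ (by simp),
      lintegral_comp_smul_addHaar (inv_ne_zero hδ.ne')
        (g := fun w => ‖w‖ₑ * ‖fderiv ℝ η₀ w‖ₑ) (by fun_prop), ← mul_assoc]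
    rw [Real.enorm_eq_ofReal (by positivity), ← ENNReal.ofReal_mul (by positivity)]
    have : (δ ^ d)⁻¹ * |(δ⁻¹ ^ Module.finrank ℝ E)⁻¹| = 1 := by
      rw [abs_of_pos (by positivity)]
      simp [d, hδd.ne']
    rw [this]
    simp

/-- Since `η` has mass one, `f * η - f` is an average of `f (· - w) - f` over `‖w‖ ≤ δ`. Tonelli
moves the weight `‖g‖ₑ` inside that average, so only translates of the product are estimated. -/
theorem lintegral_mollify_sub_smul_le {η : E → ℝ} {δ : ℝ} {C : ℝ≥0∞} (hη : IsMollifier η δ C)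
    {f : E → ℝ} {g : E → F} (hfm : StronglyMeasurable f) (hgm : StronglyMeasurable g)
    (hf : Integrable f volume) {ε : ℝ≥0∞}
    (h : ∀ a : E, ‖a‖ ≤ δ → ∫⁻ x, ‖f (x - a) • g x - f x • g x‖ₑ ≤ ε) :
    ∫⁻ x, ‖(∫ y, f y * η (x - y)) - f x‖ₑ * ‖g x‖ₑ ≤ ε := by
  obtain ⟨B, hB, -⟩ := hη.exists_bound
  have hpt : ∀ x, ‖(∫ y, f y * η (x - y)) - f x‖ₑ * ‖g x‖ₑ ≤
      ∫⁻ w, ‖η w‖ₑ * ‖f (x - w) • g x - f x • g x‖ₑ := by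
    intro x
    have e1 : ∫ y, f y * η (x - y) = ∫ w, f (x - w) * η w := by
      rw [← integral_sub_left_eq_self (fun y => f y * η (x - y)) volume x]
      simp
    have e2 : f x = ∫ w, f x * η w := by
      rw [integral_const_mul, hη.integral_eq_one, mul_one]
    have i1 : Integrable (fun w => f (x - w) * η w) volume :=
      (hf.comp_sub_left x).mul_bdd hη.continuous.aestronglyMeasurable (Eventually.of_forall hB)
    have e3 : (∫ y, f y * η (x - y)) - f x = ∫ w, (f (x - w) - f x) * η w := by
      simp only [sub_mul]
      rw [integral_sub i1 (hη.integrable.const_mul _), ← e1, ← e2]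
    rw [e3, mul_comm]
    refine (mul_le_mul_right (enorm_integral_le_lintegral_enorm _) _).trans ?_
    rw [← lintegral_const_mul' _ _ (by simp)]
    refine lintegral_mono fun w => le_of_eq ?_
    rw [← sub_smul, enorm_smul, enorm_mul]
    ring
  refine (lintegral_mono hpt).trans ?_
  rw [lintegral_lintegral_swap]
  · calc ∫⁻ w, ∫⁻ x, ‖η w‖ₑ * ‖f (x - w) • g x - f x • g x‖ₑ
        ≤ ∫⁻ w, ‖η w‖ₑ * ε := by
          refine lintegral_mono fun w => ?_
          rw [lintegral_const_mul' _ _ (by simp)]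
          rcases le_or_gt ‖w‖ δ with hw | hw
          · gcongr
            exact h w hw
          · simp [hη.eq_zero hw]
      _ = ε := by
          rw [lintegral_mul_const _ hη.continuous.enorm.measurable, hη.lintegral_eq_one, one_mul]
  · have m1 : Measurable fun z : E × E => ‖η z.2‖ₑ :=
      (hη.continuous.comp continuous_snd).enorm.measurable
    have m2 : Measurable fun z : E × E => ‖f (z.1 - z.2) • g z.1 - f z.1 • g z.1‖ₑ :=
      (((hfm.comp_measurable (by fun_prop : Measurable fun z : E × E => z.1 - z.2)).smul
        (hgm.comp_measurable measurable_fst)).sub ((hfm.comp_measurable measurable_fst).smul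
        (hgm.comp_measurable measurable_fst))).enorm
    exact (m1.mul m2).aemeasurable

end Mollifier

/-! ### The commutator estimate. -/

section Commutator

variable {E : Type*} [NormedAddCommGroup E] [InnerProductSpace ℝ E] [FiniteDimensional ℝ E]
  [MeasurableSpace E] [BorelSpace E]

theorem measurable_enorm_translate_smul_sub {F : Type*} [NormedAddCommGroup F] [NormedSpace ℝ F]
    {f : E → ℝ} {G : E → F} (hf : StronglyMeasurable f) (hG : StronglyMeasurable G) :
    Measurable fun z : (E × E) × ℝ =>
      ‖f (z.1.1 - z.1.2) • G (z.1.1 - z.2 • z.1.2) - f z.1.1 • G z.1.1‖ₑ :=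
  (((hf.comp_measurable (by fun_prop)).smul (hG.comp_measurable (by fun_prop))).sub
    ((hf.comp_measurable (by fun_prop)).smul (hG.comp_measurable (by fun_prop)))).enorm

-- Integrand of the commutator at a shift `w`, with `L = ∇η(w)`, `A s = G(x - s w)`, `a = f(x - w)`
-- and `B = f(x) G(x)`. The added term `L (B w)` pairs with the minus sign from `-w`, so that only
-- `a • A s - B` remains.
omit [MeasurableSpace E] [BorelSpace E] in
theorem enorm_mul_apply_integral_neg_add_le {μ : Measure ℝ} [IsProbabilityMeasure μ]
    {A : ℝ → E →L[ℝ] E} (hA : Integrable A μ) (L : E →L[ℝ] ℝ) (B : E →L[ℝ] E) (a : ℝ) (w : E) :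
    ‖a * L (∫ s, A s (-w) ∂μ) + L (B w)‖ₑ ≤ ‖w‖ₑ * ‖L‖ₑ * ∫⁻ s, ‖a • A s - B‖ₑ ∂μ := by
  have k1 : ∫ s, (a • A s - B) ∂μ = a • (∫ s, A s ∂μ) - B := by
    rw [integral_sub (f := fun s => a • A s) (hA.smul a) (integrable_const _), integral_smul,
      integral_const]
    simp
  have k2 : ∫ s, A s (-w) ∂μ = -((∫ s, A s ∂μ) w) := by
    rw [ContinuousLinearMap.integral_apply hA]
    simp only [map_neg, integral_neg]
  have k3 : a * L (∫ s, A s (-w) ∂μ) + L (B w) = -L ((∫ s, (a • A s - B) ∂μ) w) := by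
    rw [k1, k2]
    simp
    ring
  rw [k3, enorm_neg]
  calc _ ≤ ‖L‖ₑ * ‖(∫ s, (a • A s - B) ∂μ) w‖ₑ := ContinuousLinearMap.le_opENorm _ _
    _ ≤ ‖L‖ₑ * (‖∫ s, (a • A s - B) ∂μ‖ₑ * ‖w‖ₑ) := by
      gcongr
      exact ContinuousLinearMap.le_opENorm _ _
    _ ≤ ‖L‖ₑ * ((∫⁻ s, ‖a • A s - B‖ₑ ∂μ) * ‖w‖ₑ) := by
      gcongr
      exact enorm_integral_le_lintegral_enorm _
    _ = _ := by ring

set_option maxHeartbeats 800000 in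
/-- The commutator of mollification with transport along a divergence free Sobolev field is
controlled by the `L^1` moduli of continuity of products of translates. -/
theorem lintegral_commutator_le {Ω U : Set E} (hΩ : IsOpen Ω) (hU : IsOpen U) {δ : ℝ}
    (hUδ : ∀ x ∈ U, closedBall x δ ⊆ Ω) {η : E → ℝ} {C : ℝ≥0∞} (hη : IsMollifier η δ C)
    {f : E → ℝ} {v : E → E} {G : E → E →L[ℝ] E} (hfm : StronglyMeasurable f)
    (hvm : StronglyMeasurable v) (hGm : StronglyMeasurable G) (hf : Integrable f volume)
    (hv : Integrable v volume) (hG : Integrable G volume)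
    (hfv : Integrable (fun x => f x • v x) volume)
    (hw : ∀ φ : E → ℝ, ContDiff ℝ ∞ φ → HasCompactSupport φ → tsupport φ ⊆ Ω → ∀ y,
      ∫ x, fderiv ℝ φ x y • v x = -∫ x, φ x • G x y)
    (hdiv : ∀ φ : E → ℝ, ContDiff ℝ ∞ φ → HasCompactSupport φ → tsupport φ ⊆ Ω →
      ∫ x, fderiv ℝ φ x (v x) = 0)
    {ε : ℝ≥0∞} (hε : ∀ a b : E, ‖a‖ ≤ δ → ‖b‖ ≤ δ →
      ∫⁻ x, ‖f (x - a) • G (x - b) - f x • G x‖ₑ ≤ ε) :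
    ∫⁻ x in U, ‖∫ y, f y * fderiv ℝ η (x - y) (v y - v x)‖ₑ ≤ C * ε := by
  set μ : Measure ℝ := volume.restrict (Ioc 0 1) with hμ
  have : IsProbabilityMeasure μ := ⟨by simp [hμ]⟩
  have hΦ := measurable_enorm_translate_smul_sub hfm hGm
  obtain ⟨B, -, hB⟩ := hη.exists_bound
  let b := stdOrthonormalBasis ℝ E
  have hGseg : StronglyMeasurable fun z : (E × E) × ℝ => G (z.1.1 - z.2 • z.1.2) :=
    hGm.comp_measurable (by fun_prop)
  -- The segment formula holds for each fixed `w` off a null set of `x` depending on `w`. Joint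
  -- measurability allows the two quantifiers to be exchanged.
  have hA : ∀ᵐ x, ∀ᵐ w, x ∈ U → ‖w‖ ≤ δ →
      v (x - w) - v x = ∫ s, G (x - s • w) (-w) ∂μ := by
    rw [Measure.ae_ae_comm]
    · refine Eventually.of_forall fun w => ?_
      rcases le_or_gt ‖w‖ δ with hwδ | hwδ
      · filter_upwards [ae_sub_eq_integral_of_weakDeriv hU hv hGm hG hw (-w) (fun x hx s hs =>
          hUδ x hx (by
            rw [mem_closedBall_iff_norm, add_sub_cancel_left, norm_smul, norm_neg,
              Real.norm_of_nonneg hs.1]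
            calc s * ‖w‖ ≤ 1 * ‖w‖ := by gcongr; exact hs.2
              _ ≤ δ := by rwa [one_mul]))] with x hx hxU _
        simpa only [sub_eq_add_neg, smul_neg, intervalIntegral.integral_of_le zero_le_one]
          using hx hxU
      · exact Eventually.of_forall fun x _ h => absurd h hwδ.not_ge
    · have m1 : StronglyMeasurable fun z : E × E => v (z.1 - z.2) - v z.1 :=
        (hvm.comp_measurable (by fun_prop)).sub (hvm.comp_measurable (by fun_prop))
      have m2 : StronglyMeasurable fun z : E × E => ∫ s, G (z.1 - s • z.2) (-z.2) ∂μ := by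
        refine StronglyMeasurable.integral_prod_right (f := fun (z : E × E) s =>
          G (z.1 - s • z.2) (-z.2)) ?_
        exact isBoundedBilinearMap_apply.continuous.comp_stronglyMeasurable
          (hGseg.prodMk (by fun_prop : Measurable fun z : (E × E) × ℝ => -z.1.2).stronglyMeasurable)
      have m3 := m1.measurableSet_eq_fun m2
      have m4 : MeasurableSet {z : E × E | z.1 ∈ U} := hU.measurableSet.preimage measurable_fst
      have m5 : MeasurableSet {z : E × E | ‖z.2‖ ≤ δ} :=
        measurableSet_le (by fun_prop) measurable_const
      exact m4.imp (m5.imp m3)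
  have hI : ∀ᵐ x, ∀ᵐ w, Integrable (fun s => G (x - s • w)) μ := by
    rw [Measure.ae_ae_comm]
    · refine Eventually.of_forall fun w => ?_
      have := (integrable_comp_add_smul_prod hGm hG (-w) μ).prod_right_ae
      simpa only [smul_neg, ← sub_eq_add_neg] using this
    · exact measurableSet_integrable (f := fun (z : E × E) s => G (z.1 - s • z.2)) hGseg
  have htr := ae_sum_inner_eq_zero_of_divFree b hΩ hv hG hw hdiv
  have hmain : ∀ᵐ x, x ∈ U → ‖∫ y, f y * fderiv ℝ η (x - y) (v y - v x)‖ₑ ≤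
      ∫⁻ w, ‖w‖ₑ * ‖fderiv ℝ η w‖ₑ * ∫⁻ s, ‖f (x - w) • G (x - s • w) - f x • G x‖ₑ ∂μ := by
    filter_upwards [hA, hI, htr] with x hxA hxI hxtr hxU
    have hδ0 : 0 ≤ δ := by
      by_contra hneg
      have h0 : ∀ w, η w = 0 := fun w => hη.eq_zero ((not_le.1 hneg).trans_le (norm_nonneg w))
      have := hη.integral_eq_one
      simp [h0] at this
    have hxΩ : x ∈ Ω := hUδ x hxU (mem_closedBall_self hδ0)
    have e1 : ∫ y, f y * fderiv ℝ η (x - y) (v y - v x) =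
        ∫ w, f (x - w) * fderiv ℝ η w (v (x - w) - v x) := by
      rw [← integral_sub_left_eq_self (fun y => f y * fderiv ℝ η (x - y) (v y - v x)) volume x]
      simp
    have i1 : Integrable (fun w => f (x - w) * fderiv ℝ η w (v (x - w) - v x)) volume := by
      have j1 : Integrable (fun y => f y • (v y - v x)) volume := by
        simp only [smul_sub]
        exact hfv.sub (hf.smul_const _)
      have j2 := j1.comp_sub_left x
      refine (j2.norm.const_mul B).mono' ?_ (Eventually.of_forall fun w => ?_)
      · refine ((hfm.comp_measurable (by fun_prop)).mul ?_).aestronglyMeasurable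
        exact isBoundedBilinearMap_apply.continuous.comp_stronglyMeasurable
          (hη.continuous_fderiv.stronglyMeasurable.prodMk
            ((hvm.comp_measurable (by fun_prop)).sub stronglyMeasurable_const))
      · rw [norm_mul, norm_smul]
        calc _ ≤ ‖f (x - w)‖ * (B * ‖v (x - w) - v x‖) := by
              gcongr
              exact (ContinuousLinearMap.le_opNorm _ _).trans (by gcongr; exact hB w)
          _ = _ := by ring
    have i2 : Integrable (fun w => fderiv ℝ η w ((f x • G x) w)) volume :=
      Continuous.integrable_of_hasCompactSupport
        (by have := hη.continuous_fderiv; fun_prop)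
        ((hη.hasCompactSupport.fderiv ℝ).mono fun w hw h => hw (by
          simp only at h ⊢
          rw [h]; simp))
    -- Here the divergence condition enters: `G x` has zero trace, so the limiting value of the
    -- commutator may be added for free before absolute values are taken.
    have e2 : ∫ w, fderiv ℝ η w ((f x • G x) w) = 0 := by
      rw [integral_fderiv_apply_linear b hη.contDiff hη.hasCompactSupport]
      simp only [smul_apply, inner_smul_right, ← Finset.mul_sum, hxtr hxΩ]
      simp
    have e3 : ∫ w, f (x - w) * fderiv ℝ η w (v (x - w) - v x) =
        ∫ w, (f (x - w) * fderiv ℝ η w (v (x - w) - v x) + fderiv ℝ η w ((f x • G x) w)) := by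
      rw [integral_add i1 i2, e2, add_zero]
    rw [e1, e3]
    refine (enorm_integral_le_lintegral_enorm _).trans (lintegral_mono_ae ?_)
    filter_upwards [hxA, hxI] with w hwA hwI
    rcases le_or_gt ‖w‖ δ with hwδ | hwδ
    · rw [hwA hxU hwδ]
      exact enorm_mul_apply_integral_neg_add_le hwI _ _ _ _
    · simp [hη.fderiv_eq_zero hwδ]
  calc ∫⁻ x in U, ‖∫ y, f y * fderiv ℝ η (x - y) (v y - v x)‖ₑ
      ≤ ∫⁻ x in U, ∫⁻ w, ‖w‖ₑ * ‖fderiv ℝ η w‖ₑ *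
          ∫⁻ s, ‖f (x - w) • G (x - s • w) - f x • G x‖ₑ ∂μ :=
        lintegral_mono_ae ((ae_restrict_iff' hU.measurableSet).2 hmain)
    _ ≤ ∫⁻ x, ∫⁻ w, ‖w‖ₑ * ‖fderiv ℝ η w‖ₑ *
          ∫⁻ s, ‖f (x - w) • G (x - s • w) - f x • G x‖ₑ ∂μ := setLIntegral_le_lintegral _ _
    -- With `w` outermost, the inner `x`-integral for each `s ∈ (0,1]` is the translation modulus at
    -- the shifts `w` and `s w`, both of length at most `δ`.
    _ = ∫⁻ w, ∫⁻ x, ‖w‖ₑ * ‖fderiv ℝ η w‖ₑ *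
          ∫⁻ s, ‖f (x - w) • G (x - s • w) - f x • G x‖ₑ ∂μ := by
        have m1 : Measurable fun z : E × E => ‖z.2‖ₑ * ‖fderiv ℝ η z.2‖ₑ := by
          have := hη.continuous_fderiv
          fun_prop
        exact lintegral_lintegral_swap
          (m1.mul (hΦ.lintegral_prod_right' (ν := μ))).aemeasurable
    _ ≤ ∫⁻ w, ‖w‖ₑ * ‖fderiv ℝ η w‖ₑ * ε := by
        refine lintegral_mono fun w => ?_
        rw [lintegral_const_mul' _ _ (ENNReal.mul_ne_top (by simp) (by simp))]
        rcases le_or_gt ‖w‖ δ with hwδ | hwδ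
        · gcongr
          rw [lintegral_lintegral_swap]
          · calc _ ≤ ∫⁻ _s, ε ∂μ := by
                  refine setLIntegral_mono measurable_const fun s hs => hε w (s • w) hwδ ?_
                  rw [norm_smul, Real.norm_of_nonneg hs.1.le]
                  calc s * ‖w‖ ≤ 1 * ‖w‖ := by gcongr; exact hs.2
                    _ ≤ δ := by rwa [one_mul]
              _ = ε := by simp [hμ]
          · exact (hΦ.comp (by fun_prop : Measurable fun z : E × ℝ =>
              ((z.1, w), z.2))).aemeasurable
        · have h0 : ‖fderiv ℝ η w‖ₑ = 0 := by
            rw [hη.fderiv_eq_zero hwδ, ← ofReal_norm, norm_zero, ENNReal.ofReal_zero]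
          rw [h0, mul_zero, zero_mul, zero_mul]
    _ ≤ C * ε := by
        rw [lintegral_mul_const _ (by have := hη.continuous_fderiv; fun_prop)]
        gcongr
        exact hη.moment_le

end Commutator

/-! ### The weak equation `m' = h`, `m(0) = m₀` in time and its chain rule. -/

section Time

/-- A primitive of `ψ` has compact support only if `ψ` has mean zero. Subtracting a copy of `ψ`
shifted into `(-T,0)` enforces this without changing `ψ` on `(0,T)`; the value of `χ` at `0` stays
free, which lets the initial datum be seen. -/
theorem exists_primitive_vanishing {T : ℝ} {ψ : ℝ → ℝ} (hψ : ContDiff ℝ ∞ ψ)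
    (hψc : HasCompactSupport ψ) (hψT : tsupport ψ ⊆ Ioo 0 T) :
    ∃ χ : ℝ → ℝ, ContDiff ℝ ∞ χ ∧ HasCompactSupport χ ∧ tsupport χ ⊆ Iio T ∧
      ∀ t ∈ Ioo 0 T, deriv χ t = ψ t := by
  have hz : ∀ t, t ∉ Ioo 0 T → ψ t = 0 := fun t ht =>
    image_eq_zero_of_notMem_tsupport fun h => ht (hψT h)
  have hψ' := hψ.continuous
  set κ : ℝ → ℝ := fun t => ψ t - ψ (t + T) with hκ
  have hκs : ContDiff ℝ ∞ κ := by fun_prop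
  have hκc : Continuous κ := hκs.continuous
  set χ : ℝ → ℝ := fun t => ∫ s in (-T)..t, κ s with hχ
  have hder : ∀ t, HasDerivAt χ (κ t) t := fun t =>
    intervalIntegral.integral_hasDerivAt_right (hκc.intervalIntegrable _ _)
      hκc.stronglyMeasurable.stronglyMeasurableAtFilter hκc.continuousAt
  have hderiv : deriv χ = κ := funext fun t => (hder t).deriv
  have hχs : ContDiff ℝ ∞ χ := by
    rw [contDiff_infty_iff_deriv]
    exact ⟨fun t => (hder t).differentiableAt, by rwa [hderiv]⟩
  obtain ⟨c, d, hcd, hd⟩ : ∃ c d : ℝ, (∀ t ∈ tsupport ψ, c ≤ t ∧ t ≤ d) ∧ (d < T ∧ 0 < c ∨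
      tsupport ψ = ∅) := by
    rcases (tsupport ψ).eq_empty_or_nonempty with he | hne
    · exact ⟨0, 0, by simp [he], Or.inr he⟩
    · obtain ⟨m, hm, hmin⟩ := hψc.exists_isLeast hne
      obtain ⟨M, hM, hmax⟩ := hψc.exists_isGreatest hne
      exact ⟨m, M, fun t ht => ⟨hmin ht, hmax ht⟩, Or.inl ⟨(hψT hM).2, (hψT hm).1⟩⟩
  rcases hd with ⟨hdT, hc⟩ | he
  swap
  · have h0 : ∀ t, ψ t = 0 := fun t => image_eq_zero_of_notMem_tsupport (by simp [he])
    exact ⟨0, contDiff_const, HasCompactSupport.zero, by simp, fun t _ => by simp [h0]⟩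
  have hzc : ∀ t, t < c → ψ t = 0 := fun t ht =>
    image_eq_zero_of_notMem_tsupport fun h => (hcd t h).1.not_gt ht
  have hzd : ∀ t, d < t → ψ t = 0 := fun t ht =>
    image_eq_zero_of_notMem_tsupport fun h => (hcd t h).2.not_gt ht
  have hint : ∫ s in (-T)..T, κ s = 0 := by
    have i1 : ∀ a b, IntervalIntegrable ψ volume a b := fun a b => hψ'.intervalIntegrable a b
    have i2 : ∀ a b, IntervalIntegrable (fun s => ψ (s + T)) volume a b :=
      fun a b => Continuous.intervalIntegrable (by fun_prop) a b
    rw [hκ, intervalIntegral.integral_sub (i1 _ _) (i2 _ _),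
      intervalIntegral.integral_comp_add_right (fun s => ψ s), neg_add_cancel]
    rw [← intervalIntegral.integral_add_adjacent_intervals (i1 (-T) 0) (i1 0 T),
      ← intervalIntegral.integral_add_adjacent_intervals (i1 0 T) (i1 T (T + T))]
    have e1 : ∫ s in (-T)..0, ψ s = 0 := by
      rw [intervalIntegral.integral_congr_ae (g := fun _ => 0)]
      · simp
      · refine Eventually.of_forall fun s hs => hz s fun h => ?_
        have hT := h.1.trans h.2
        rw [uIoc_of_le (by linarith)] at hs
        exact hs.2.not_gt h.1
    have e2 : ∫ s in T..(T + T), ψ s = 0 := by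
      rw [intervalIntegral.integral_congr_ae (g := fun _ => 0)]
      · simp
      · refine Eventually.of_forall fun s hs => hz s fun h => ?_
        have hT := h.1.trans h.2
        rw [uIoc_of_le (by linarith)] at hs
        exact hs.1.not_gt h.2
    rw [e1, e2]
    ring
  have hlow : ∀ t, t < c - T → χ t = 0 := by
    intro t ht
    simp only [hχ]
    rw [intervalIntegral.integral_congr_ae (g := fun _ => 0)]
    · simp
    · refine Eventually.of_forall fun s hs => ?_
      have hs' : s < c - T := by
        have := hs.2
        rcases le_total (-T) t with h | h
        · rw [max_eq_right h] at this; linarith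
        · rw [max_eq_left h] at this; linarith
      by_cases hT : 0 < T
      · simp only [hκ]; rw [hzc s (by linarith), hzc (s + T) (by linarith), sub_zero]
      · have h0 : ∀ t, ψ t = 0 := fun t => hz t fun h => hT (h.1.trans h.2)
        simp [hκ, h0]
  have hhigh : ∀ t, d < t → χ t = 0 := by
    intro t ht
    have hadd := intervalIntegral.integral_add_adjacent_intervals
      (hκc.intervalIntegrable (-T) T (μ := volume)) (hκc.intervalIntegrable T t)
    simp only [hχ]
    rw [← hadd, hint, zero_add, intervalIntegral.integral_congr_ae (g := fun _ => 0)]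
    · simp
    · refine Eventually.of_forall fun s hs => ?_
      have hs' : d < s := (lt_min hdT ht).trans hs.1
      by_cases hT : 0 < T
      · simp only [hκ]; rw [hzd s hs', hzd (s + T) (by linarith), sub_zero]
      · have h0 : ∀ t, ψ t = 0 := fun t => hz t fun h => hT (h.1.trans h.2)
        simp [hκ, h0]
  have hsupp : tsupport χ ⊆ Icc (c - T) d := by
    refine closure_minimal (fun t ht => ⟨?_, ?_⟩) isClosed_Icc
    · by_contra h; exact ht (hlow t (not_le.1 h))
    · by_contra h; exact ht (hhigh t (not_le.1 h))
  refine ⟨χ, hχs, isCompact_Icc.of_isClosed_subset (isClosed_tsupport _) hsupp,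
    fun t ht => (hsupp ht).2.trans_lt hdT, fun t ht => ?_⟩
  rw [(hder t).deriv]
  simp only [hκ]
  rw [hz (t + T) fun h => by linarith [h.2, ht.1], sub_zero]

/-- A function whose weak derivative is `h` and whose initial value is `m₀` is a primitive of `h`
starting from `m₀`. -/
theorem ae_eq_primitive_of_weak {T : ℝ} (hT : 0 < T) {m h : ℝ → ℝ} {m₀ : ℝ}
    (hm : IntegrableOn m (Ioo 0 T)) (hh : IntegrableOn h (Ioo 0 T))
    (hweak : ∀ χ : ℝ → ℝ, ContDiff ℝ ∞ χ → HasCompactSupport χ → tsupport χ ⊆ Iio T →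
      -(∫ t in Ioo 0 T, m t * deriv χ t) - m₀ * χ 0 = ∫ t in Ioo 0 T, χ t * h t) :
    ∀ᵐ t, t ∈ Ioo 0 T → m t = m₀ + ∫ s in (0 : ℝ)..t, h s := by
  have hhi : IntervalIntegrable h volume 0 T := by
    rwa [intervalIntegrable_iff_integrableOn_Ioo_of_le hT.le]
  have hac := hhi.absolutelyContinuousOnInterval_intervalIntegral (c := 0) (by simp)
  have hR : IntegrableOn (fun t => ∫ s in (0 : ℝ)..t, h s) (Ioo 0 T) := by
    have := hac.continuousOn
    rw [uIcc_of_le hT.le] at this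
    exact (this.integrableOn_compact isCompact_Icc).mono_set Ioo_subset_Icc_self
  have hd := hhi.ae_hasDerivAt_integral
  have hconst : ∀ c : ℝ, IntegrableOn (fun _ : ℝ => c) (Ioo 0 T) := fun c =>
    integrableOn_const (by simp)
  -- The difference from the primitive is tested with an arbitrary `ψ`, written as `χ'` on `(0,T)`.
  -- The hypothesis and integration by parts give the same value for both parts, including the
  -- boundary term at `0`.
  have key := isOpen_Ioo.ae_eq_zero_of_integral_contDiff_smul_eq_zero (μ := volume)
    (U := Ioo 0 T) (f := fun t => m t - (m₀ + ∫ s in (0 : ℝ)..t, h s))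
    (hm.sub ((hconst m₀).add hR)).locallyIntegrableOn ?_
  · filter_upwards [key] with t ht htT
    exact sub_eq_zero.1 (ht htT)
  intro ψ hψ hψc hψT
  obtain ⟨χ, hχ, hχc, hχT, hχψ⟩ := exists_primitive_vanishing hψ hψc hψT
  have hχ1 : Continuous (deriv χ) := hχ.continuous_deriv (by simp)
  have hχTz : χ T = 0 := image_eq_zero_of_notMem_tsupport fun h => lt_irrefl T (hχT h)
  have hparts := AbsolutelyContinuousOnInterval.integral_mul_deriv_eq_deriv_mul hac
    ((hχ.of_le (by simp)).contDiffOn.absolutelyContinuousOnInterval (a := 0) (b := T))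
  have e1 : ∫ t in (0 : ℝ)..T, deriv (fun t => ∫ s in (0 : ℝ)..t, h s) t * χ t =
      ∫ t in (0 : ℝ)..T, h t * χ t := by
    refine intervalIntegral.integral_congr_ae ?_
    filter_upwards [hd] with t ht htT
    rw [(ht (uIoc_subset_uIcc htT) 0 (by simp)).deriv]
  have e2 : ∫ t in (0 : ℝ)..T, deriv χ t = -χ 0 := by
    rw [intervalIntegral.integral_deriv_eq_sub (fun t _ => hχ.differentiable (by simp) t)
      (hχ1.intervalIntegrable _ _), hχTz, zero_sub]
  simp only [hχTz, e1, mul_zero, intervalIntegral.integral_same, zero_mul, sub_zero,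
    zero_sub] at hparts
  have toI : ∀ f : ℝ → ℝ, ∫ t in (0 : ℝ)..T, f t = ∫ t in Ioo 0 T, f t := fun f => by
    rw [intervalIntegral.integral_of_le hT.le, integral_Ioc_eq_integral_Ioo]
  rw [toI, toI] at hparts
  rw [toI] at e2
  have hw := hweak χ hχ hχc hχT
  have hb : ∀ {f : ℝ → ℝ}, IntegrableOn f (Ioo 0 T) →
      IntegrableOn (fun t => f t * deriv χ t) (Ioo 0 T) := by
    intro f hf
    obtain ⟨C, hC⟩ := hχc.deriv.exists_bound_of_continuous hχ1
    exact Integrable.mul_bdd hf hχ1.aestronglyMeasurable (Eventually.of_forall hC)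
  have e3 : ∫ x, ψ x • (m x - (m₀ + ∫ s in (0 : ℝ)..x, h s)) =
      ∫ t in Ioo 0 T, (m t * deriv χ t - (m₀ * deriv χ t +
        (∫ s in (0 : ℝ)..t, h s) * deriv χ t)) := by
    rw [← setIntegral_eq_integral_of_forall_compl_eq_zero (s := Ioo 0 T)]
    · refine setIntegral_congr_fun measurableSet_Ioo fun t ht => ?_
      simp only [hχψ t ht, smul_eq_mul]
      ring
    · intro t ht
      rw [image_eq_zero_of_notMem_tsupport fun h => ht (hψT h), zero_smul]
  have e5 := integral_sub (hb hm) ((hb (hconst m₀)).add (hb hR))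
  simp only [Pi.add_apply] at e5
  rw [e3, e5, integral_add (hb (hconst m₀)) (hb hR), integral_const_mul, e2, hparts]
  have e4 : ∫ t in Ioo 0 T, h t * χ t = ∫ t in Ioo 0 T, χ t * h t := by simp only [mul_comm]
  rw [e4]
  linarith

theorem absolutelyContinuousOnInterval_comp_lipschitz {β R : ℝ → ℝ} {K : NNReal}
    (hK : LipschitzWith K β) {a b : ℝ} (hR : AbsolutelyContinuousOnInterval R a b) :
    AbsolutelyContinuousOnInterval (fun t => β (R t)) a b := by
  rw [absolutelyContinuousOnInterval_iff] at hR ⊢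
  intro ε hε
  -- `K + 1` rather than `K` covers the case `K = 0`.
  obtain ⟨δ, hδ, h⟩ := hR (ε / (K + 1)) (by positivity)
  refine ⟨δ, hδ, fun S hS hSδ => ?_⟩
  calc ∑ i ∈ Finset.range S.1, dist (β (R (S.2 i).1)) (β (R (S.2 i).2))
      ≤ ∑ i ∈ Finset.range S.1, K * dist (R (S.2 i).1) (R (S.2 i).2) :=
        Finset.sum_le_sum fun i _ => hK.dist_le_mul _ _
    _ = K * ∑ i ∈ Finset.range S.1, dist (R (S.2 i).1) (R (S.2 i).2) := by rw [Finset.mul_sum]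
    _ ≤ (K + 1) * ∑ i ∈ Finset.range S.1, dist (R (S.2 i).1) (R (S.2 i).2) := by
        gcongr
        linarith
    _ < (K + 1) * (ε / (K + 1)) := by
        gcongr
        exact h S hS hSδ
    _ = ε := by field_simp

/-- Chain rule in time for the weak formulation of `m' = h`, `m(0) = m₀`. -/
theorem weak_chain_rule {T : ℝ} (hT : 0 < T) {m h : ℝ → ℝ} {m₀ : ℝ}
    (hm : IntegrableOn m (Ioo 0 T)) (hh : IntegrableOn h (Ioo 0 T))
    (hweak : ∀ χ : ℝ → ℝ, ContDiff ℝ ∞ χ → HasCompactSupport χ → tsupport χ ⊆ Iio T →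
      -(∫ t in Ioo 0 T, m t * deriv χ t) - m₀ * χ 0 = ∫ t in Ioo 0 T, χ t * h t)
    {β : ℝ → ℝ} (hβ : ContDiff ℝ 1 β) {K : NNReal} (hK : LipschitzWith K β)
    {χ : ℝ → ℝ} (hχ : ContDiff ℝ 1 χ) (hχT : χ T = 0) :
    -(∫ t in Ioo 0 T, β (m t) * deriv χ t) - β m₀ * χ 0 =
      ∫ t in Ioo 0 T, χ t * (deriv β (m t) * h t) := by
  have hae := ae_eq_primitive_of_weak hT hm hh hweak
  have hhi : IntervalIntegrable h volume 0 T := by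
    rwa [intervalIntegrable_iff_integrableOn_Ioo_of_le hT.le]
  set R : ℝ → ℝ := fun t => m₀ + ∫ s in (0 : ℝ)..t, h s with hR
  have hac : AbsolutelyContinuousOnInterval R 0 T := by
    have h1 := hhi.absolutelyContinuousOnInterval_intervalIntegral (c := 0) (by simp)
    have h2 : AbsolutelyContinuousOnInterval (fun _ : ℝ => m₀) 0 T :=
      (contDiff_const.contDiffOn (n := 1)).absolutelyContinuousOnInterval
    exact h2.add h1
  have hβR : AbsolutelyContinuousOnInterval (fun t => β (R t)) 0 T :=
    absolutelyContinuousOnInterval_comp_lipschitz hK hac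
  have hd := hhi.ae_hasDerivAt_integral
  have hparts := AbsolutelyContinuousOnInterval.integral_mul_deriv_eq_deriv_mul hβR
    (hχ.contDiffOn.absolutelyContinuousOnInterval (a := 0) (b := T))
  have e1 : ∫ t in (0 : ℝ)..T, deriv (fun t => β (R t)) t * χ t =
      ∫ t in (0 : ℝ)..T, χ t * (deriv β (R t) * h t) := by
    refine intervalIntegral.integral_congr_ae ?_
    filter_upwards [hd] with t ht htT
    have h1 : HasDerivAt R (h t) t := (ht (uIoc_subset_uIcc htT) 0 (by simp)).const_add m₀
    have h2 : HasDerivAt (fun t => β (R t)) (deriv β (R t) * h t) t :=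
      ((hβ.differentiable (by simp)) (R t)).hasDerivAt.comp t h1
    rw [h2.deriv, mul_comm]
  have hR0 : R 0 = m₀ := by simp [hR]
  have toI : ∀ f : ℝ → ℝ, ∫ t in (0 : ℝ)..T, f t = ∫ t in Ioo 0 T, f t := fun f => by
    rw [intervalIntegral.integral_of_le hT.le, integral_Ioc_eq_integral_Ioo]
  rw [e1, hχT, hR0, toI, toI] at hparts
  -- The chain rule was carried out for the absolutely continuous representative `R`; it transfers
  -- to `m` because the two agree a.e.
  have c1 : ∫ t in Ioo 0 T, β (m t) * deriv χ t = ∫ t in Ioo 0 T, β (R t) * deriv χ t := by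
    refine setIntegral_congr_ae measurableSet_Ioo ?_
    filter_upwards [hae] with t ht htT
    rw [ht htT]
  have c2 : ∫ t in Ioo 0 T, χ t * (deriv β (m t) * h t) =
      ∫ t in Ioo 0 T, χ t * (deriv β (R t) * h t) := by
    refine setIntegral_congr_ae measurableSet_Ioo ?_
    filter_upwards [hae] with t ht htT
    rw [ht htT]
  rw [c1, c2, hparts]
  ring

end Time

/-! ### Space-time test functions and their slices. -/

section TestFunctions

variable {E : Type*} [NormedAddCommGroup E] [NormedSpace ℝ E]

/-- Smooth functions with compact support in `(-∞,T) × Ω`. -/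
structure IsTest (T : ℝ) (Ω : Set E) (φ : ℝ × E → ℝ) : Prop where
  contDiff : ContDiff ℝ ∞ φ
  hasCompactSupport : HasCompactSupport φ
  tsupport_subset : tsupport φ ⊆ Iio T ×ˢ Ω

namespace IsTest

variable {T : ℝ} {Ω : Set E} {φ : ℝ × E → ℝ}

theorem continuous_fderiv (hφ : IsTest T Ω φ) : Continuous (fderiv ℝ φ) :=
  hφ.contDiff.continuous_fderiv (by simp)

theorem hasCompactSupport_fderiv (hφ : IsTest T Ω φ) : HasCompactSupport (fderiv ℝ φ) :=
  hφ.hasCompactSupport.fderiv ℝ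

theorem isCompact_image_snd (hφ : IsTest T Ω φ) : IsCompact (Prod.snd '' tsupport φ) :=
  IsCompact.image hφ.hasCompactSupport continuous_snd

theorem image_snd_subset (hφ : IsTest T Ω φ) : Prod.snd '' tsupport φ ⊆ Ω := by
  rintro x ⟨z, hz, rfl⟩
  exact (hφ.tsupport_subset hz).2

omit [NormedSpace ℝ E] in
theorem eq_zero (φ : ℝ × E → ℝ) {x : E} (hx : x ∉ Prod.snd '' tsupport φ) (t : ℝ) :
    φ (t, x) = 0 :=
  image_eq_zero_of_notMem_tsupport fun h => hx ⟨_, h, rfl⟩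

theorem fderiv_eq_zero (φ : ℝ × E → ℝ) {x : E} (hx : x ∉ Prod.snd '' tsupport φ) (t : ℝ) :
    fderiv ℝ φ (t, x) = 0 :=
  image_eq_zero_of_notMem_tsupport fun h => hx ⟨_, tsupport_fderiv_subset ℝ h, rfl⟩

theorem eq_zero_of_notMem (hφ : IsTest T Ω φ) {x : E} (hx : x ∉ Ω) (t : ℝ) : φ (t, x) = 0 :=
  eq_zero φ (fun h => hx (hφ.image_snd_subset h)) t

theorem fderiv_eq_zero_of_notMem (hφ : IsTest T Ω φ) {x : E} (hx : x ∉ Ω) (t : ℝ) :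
    fderiv ℝ φ (t, x) = 0 :=
  fderiv_eq_zero φ (fun h => hx (hφ.image_snd_subset h)) t

theorem apply_final (hφ : IsTest T Ω φ) (x : E) : φ (T, x) = 0 :=
  image_eq_zero_of_notMem_tsupport fun h => lt_irrefl T (hφ.tsupport_subset h).1

theorem exists_bound (hφ : IsTest T Ω φ) :
    ∃ B : ℝ, 0 ≤ B ∧ (∀ z, ‖φ z‖ ≤ B) ∧ ∀ z, ‖fderiv ℝ φ z‖ ≤ B := by
  obtain ⟨B₁, h₁⟩ := hφ.hasCompactSupport.exists_bound_of_continuous hφ.contDiff.continuous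
  obtain ⟨B₂, h₂⟩ := hφ.hasCompactSupport_fderiv.exists_bound_of_continuous
    hφ.continuous_fderiv
  exact ⟨max B₁ B₂, ((norm_nonneg _).trans (h₁ 0)).trans (le_max_left _ _),
    fun w => (h₁ w).trans (le_max_left _ _), fun w => (h₂ w).trans (le_max_right _ _)⟩

theorem contDiff_space (hφ : IsTest T Ω φ) (t : ℝ) : ContDiff ℝ ∞ fun x => φ (t, x) :=
  hφ.contDiff.comp (by fun_prop)

theorem tsupport_space_subset (hφ : IsTest T Ω φ) (t : ℝ) :
    tsupport (fun x => φ (t, x)) ⊆ Prod.snd '' tsupport φ :=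
  closure_minimal (fun _ hx => by_contra fun h => hx (eq_zero φ h t))
    hφ.isCompact_image_snd.isClosed

theorem hasCompactSupport_space (hφ : IsTest T Ω φ) (t : ℝ) :
    HasCompactSupport fun x => φ (t, x) :=
  hφ.isCompact_image_snd.of_isClosed_subset (isClosed_tsupport _) (hφ.tsupport_space_subset t)

theorem fderiv_space (hφ : IsTest T Ω φ) (t : ℝ) (x w : E) :
    fderiv ℝ (fun x => φ (t, x)) x w = fderiv ℝ φ (t, x) (0, w) := by
  have h1 : HasFDerivAt (fun x : E => (t, x)) (ContinuousLinearMap.inr ℝ ℝ E) x :=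
    hasFDerivAt_prodMk_right t x
  have h2 := ((hφ.contDiff.differentiable (by simp)) (t, x)).hasFDerivAt.comp x h1
  have h3 := h2.fderiv
  simp only [Function.comp_def] at h3
  rw [h3]
  simp

theorem hasDerivAt_time (hφ : IsTest T Ω φ) (t : ℝ) (x : E) :
    HasDerivAt (fun s => φ (s, x)) (fderiv ℝ φ (t, x) (1, 0)) t := by
  have h1 : HasDerivAt (fun s : ℝ => (s, x)) ((1 : ℝ), (0 : E)) t :=
    (hasDerivAt_id t).prodMk (hasDerivAt_const t x)
  exact ((hφ.contDiff.differentiable (by simp)) (t, x)).hasFDerivAt.comp_hasDerivAt t h1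

theorem deriv_time (hφ : IsTest T Ω φ) (t : ℝ) (x : E) :
    deriv (fun s => φ (s, x)) t = fderiv ℝ φ (t, x) (1, 0) :=
  (hφ.hasDerivAt_time t x).deriv

end IsTest

end TestFunctions

/-! ### Spatial mollification, flux and commutator at a fixed time. -/

section Mollify

variable {E : Type*} [NormedAddCommGroup E] [InnerProductSpace ℝ E] [FiniteDimensional ℝ E]
  [MeasurableSpace E] [BorelSpace E]

/-- Mollification of `f` by the kernel `η`. -/
noncomputable def mollify (η f : E → ℝ) (x : E) : ℝ := ∫ y, f y * η (x - y)

/-- Mollification of `div (f v)` by the kernel `η`. -/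
noncomputable def flux (η f : E → ℝ) (v : E → E) (x : E) : ℝ :=
  ∫ y, f y * fderiv ℝ η (x - y) (v y)

/-- The commutator of mollification with transport along `v`. -/
noncomputable def commutator (η f : E → ℝ) (v : E → E) (x : E) : ℝ :=
  ∫ y, f y * fderiv ℝ η (x - y) (v y - v x)

variable {η f : E → ℝ} {v : E → E} {δ : ℝ} {C : ℝ≥0∞}

theorem mollify_eq_convolution (η f : E → ℝ) :
    mollify η f = convolution f η (ContinuousLinearMap.lsmul ℝ ℝ) volume := by
  ext x
  simp [mollify, convolution_def]

theorem contDiff_mollify (hη : IsMollifier η δ C) (hf : Integrable f volume) :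
    ContDiff ℝ ∞ (mollify η f) := by
  rw [mollify_eq_convolution]
  exact hη.hasCompactSupport.contDiff_convolution_right _ hf.locallyIntegrable hη.contDiff

theorem integrable_mul_fderiv_apply (hη : IsMollifier η δ C) (hf : AEStronglyMeasurable f volume)
    (hv : AEStronglyMeasurable v volume) (hfv : Integrable (fun y => f y • v y) volume) (x : E) :
    Integrable (fun y => f y * fderiv ℝ η (x - y) (v y)) volume := by
  obtain ⟨B, -, hB⟩ := hη.exists_bound
  have hη1 := hη.continuous_fderiv
  refine (hfv.norm.const_mul B).mono' (hf.mul ?_) (Eventually.of_forall fun y => ?_)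
  · exact isBoundedBilinearMap_apply.continuous.comp_aestronglyMeasurable
      ((by fun_prop : Continuous fun y => fderiv ℝ η (x - y)).aestronglyMeasurable.prodMk hv)
  · rw [norm_mul, norm_smul]
    calc _ ≤ ‖f y‖ * (B * ‖v y‖) := by
          gcongr
          exact (ContinuousLinearMap.le_opNorm _ _).trans (by gcongr; exact hB _)
      _ = _ := by ring

theorem fderiv_mollify_apply (hη : IsMollifier η δ C) (hf : Integrable f volume) (x w : E) :
    fderiv ℝ (mollify η f) x w = ∫ y, f y * fderiv ℝ η (x - y) w := by
  obtain ⟨B, hB, hB'⟩ := hη.exists_bound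
  have hη0 := hη.continuous
  have hη1 := hη.continuous_fderiv
  have i1 : ∀ x, Integrable (fun y => f y * η (x - y)) volume := fun x =>
    hf.mul_bdd (by fun_prop) (Eventually.of_forall fun y => hB (x - y))
  have i2 : ∀ x, Integrable (fun y => f y • fderiv ℝ η (x - y)) volume := fun x =>
    hf.smul_bdd B (by fun_prop) (Eventually.of_forall fun y => hB' (x - y))
  have h : HasFDerivAt (mollify η f) (∫ y, f y • fderiv ℝ η (x - y)) x := by
    refine hasFDerivAt_integral_of_dominated_of_fderiv_le (𝕜 := ℝ) (s := univ)
      (F := fun x y => f y * η (x - y)) (F' := fun x y => f y • fderiv ℝ η (x - y))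
      (bound := fun y => ‖f y‖ * B) univ_mem
      (Eventually.of_forall fun x => (i1 x).1) (i1 x) (i2 x).1
      (Eventually.of_forall fun y x _ => ?_) (hf.norm.mul_const B)
      (Eventually.of_forall fun y x _ => ?_)
    · rw [norm_smul]
      gcongr
      exact hB' _
    · have h1 : HasFDerivAt (fun x => η (x - y)) (fderiv ℝ η (x - y)) x := by
        have := ((hη.contDiff.differentiable (by simp)) (x - y)).hasFDerivAt
        simpa [Function.comp_def] using this.comp x ((hasFDerivAt_id x).sub_const y)
      exact h1.const_mul (f y)
  rw [h.fderiv, ContinuousLinearMap.integral_apply (i2 x)]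
  simp

/-- Splitting `v y = (v y - v x) + v x` under the integral isolates transport of the mollified
function by the local velocity. This turns the mollified equation into the transport equation with a
commutator as source. -/
theorem flux_eq_commutator_add (hη : IsMollifier η δ C) (hf : Integrable f volume)
    (hv : AEStronglyMeasurable v volume) (hfv : Integrable (fun y => f y • v y) volume) (x : E) :
    flux η f v x = commutator η f v x + fderiv ℝ (mollify η f) x (v x) := by
  have h1 := integrable_mul_fderiv_apply hη hf.1 hv hfv x
  have h2 := integrable_mul_fderiv_apply hη hf.1 (v := fun _ => v x) aestronglyMeasurable_const
    (hf.smul_const _) x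
  rw [fderiv_mollify_apply hη hf, commutator, flux]
  simp only [map_sub, mul_sub]
  rw [integral_sub h1 h2, sub_add_cancel]

theorem norm_flux_le {B : ℝ} (hB : ∀ w, ‖fderiv ℝ η w‖ ≤ B)
    (hfv : Integrable (fun y => f y • v y) volume) (x : E) :
    ‖flux η f v x‖ ≤ B * ∫ y, ‖f y • v y‖ := by
  rw [← integral_const_mul]
  refine norm_integral_le_of_norm_le (hfv.norm.const_mul B) (Eventually.of_forall fun y => ?_)
  rw [norm_mul, norm_smul]
  calc _ ≤ ‖f y‖ * (B * ‖v y‖) := by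
        gcongr
        exact (ContinuousLinearMap.le_opNorm _ _).trans (by gcongr; exact hB _)
    _ = _ := by ring

theorem integrable_clm_apply {L : E → E →L[ℝ] ℝ} (hL : Continuous L) {B : ℝ}
    (hB : ∀ x, ‖L x‖ ≤ B) (hv : Integrable v volume) : Integrable (fun x => L x (v x)) volume := by
  refine (hv.norm.const_mul B).mono' ?_ (Eventually.of_forall fun x =>
    (ContinuousLinearMap.le_opNorm _ _).trans (by gcongr; exact hB x))
  exact isBoundedBilinearMap_apply.continuous.comp_aestronglyMeasurable
    (hL.aestronglyMeasurable.prodMk hv.1)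

/-- Renormalised test functions are orthogonal to divergence free fields. -/
theorem integral_renormalized_flux {Ω : Set E} (hη : IsMollifier η δ C) (hf : Integrable f volume)
    (hv : Integrable v volume) (hfv : Integrable (fun y => f y • v y) volume)
    (hdiv : ∀ φ : E → ℝ, ContDiff ℝ ∞ φ → HasCompactSupport φ → tsupport φ ⊆ Ω →
      ∫ x, fderiv ℝ φ x (v x) = 0)
    {β : ℝ → ℝ} (hβ : ContDiff ℝ ∞ β) {ψ : E → ℝ} (hψ : ContDiff ℝ ∞ ψ)
    (hψc : HasCompactSupport ψ) (hψΩ : tsupport ψ ⊆ Ω)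
    (hint : Integrable (fun x => ψ x * (deriv β (mollify η f x) * flux η f v x)) volume) :
    (∫ x, ψ x * (deriv β (mollify η f x) * flux η f v x)) +
        ∫ x, β (mollify η f x) * fderiv ℝ ψ x (v x) =
      ∫ x, ψ x * (deriv β (mollify η f x) * commutator η f v x) := by
  set m := mollify η f with hm
  have hms : ContDiff ℝ ∞ m := contDiff_mollify hη hf
  have hm1 : Continuous (fderiv ℝ m) := hms.continuous_fderiv (by simp)
  have hψ1 : Continuous (fderiv ℝ ψ) := hψ.continuous_fderiv (by simp)
  have hβ1 : Continuous (deriv β) := hβ.continuous_deriv (by simp)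
  have hmc := hms.continuous
  have hβc := hβ.continuous
  have hψcont := hψ.continuous
  have hg : ContDiff ℝ ∞ fun x => ψ x * β (m x) := hψ.mul (hβ.comp hms)
  have hfd : ∀ x, fderiv ℝ (fun x => ψ x * β (m x)) x =
      (ψ x * deriv β (m x)) • fderiv ℝ m x + β (m x) • fderiv ℝ ψ x := by
    intro x
    have h1 : HasFDerivAt (fun x => β (m x)) (deriv β (m x) • fderiv ℝ m x) x :=
      ((hβ.differentiable (by simp)) (m x)).hasDerivAt.comp_hasFDerivAt x
        ((hms.differentiable (by simp)) x).hasFDerivAt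
    have h2 := (((hψ.differentiable (by simp)) x).hasFDerivAt.mul h1).fderiv
    refine h2.trans ?_
    rw [smul_smul]
  -- The product `ψ β(m)` is an admissible test function only because `β` and `m` are smooth. The
  -- two terms of its gradient exchange the transport term for the one with `∇ψ`.
  have h0 := hdiv _ hg hψc.mul_right ((tsupport_mul_subset_left (f := ψ)).trans hψΩ)
  have hs1 : Function.support (fun x => (ψ x * deriv β (m x)) • fderiv ℝ m x) ⊆
      Function.support ψ := by
    intro x hx h
    exact hx (by simp only; rw [h, zero_mul, zero_smul])
  have hs2 : Function.support (fun x => β (m x) • fderiv ℝ ψ x) ⊆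
      Function.support (fderiv ℝ ψ) := by
    intro x hx h
    exact hx (by simp only; rw [h, smul_zero])
  obtain ⟨B₁, hB₁⟩ : ∃ B, ∀ x, ‖(ψ x * deriv β (m x)) • fderiv ℝ m x‖ ≤ B :=
    HasCompactSupport.exists_bound_of_continuous (f := fun x => (ψ x * deriv β (m x)) •
      fderiv ℝ m x) (hψc.mono hs1) (by fun_prop)
  obtain ⟨B₂, hB₂⟩ : ∃ B, ∀ x, ‖β (m x) • fderiv ℝ ψ x‖ ≤ B :=
    HasCompactSupport.exists_bound_of_continuous (f := fun x => β (m x) • fderiv ℝ ψ x)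
      ((hψc.fderiv ℝ).mono hs2) (by fun_prop)
  have i1 : Integrable (fun x => ψ x * deriv β (m x) * fderiv ℝ m x (v x)) volume :=
    integrable_clm_apply (L := fun x => (ψ x * deriv β (m x)) • fderiv ℝ m x)
      (by fun_prop) hB₁ hv
  have i2 : Integrable (fun x => β (m x) * fderiv ℝ ψ x (v x)) volume :=
    integrable_clm_apply (L := fun x => β (m x) • fderiv ℝ ψ x) (by fun_prop) hB₂ hv
  have e0 : ∀ x, fderiv ℝ (fun x => ψ x * β (m x)) x (v x) =
      ψ x * deriv β (m x) * fderiv ℝ m x (v x) + β (m x) * fderiv ℝ ψ x (v x) := fun x => by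
    rw [hfd]
    rfl
  rw [integral_congr_ae (Eventually.of_forall e0), integral_add i1 i2] at h0
  have e1 : ∫ x, ψ x * (deriv β (m x) * commutator η f v x) =
      ∫ x, (ψ x * (deriv β (m x) * flux η f v x) - ψ x * deriv β (m x) * fderiv ℝ m x (v x)) := by
    refine integral_congr_ae (Eventually.of_forall fun x => ?_)
    simp only [flux_eq_commutator_add hη hf hv.1 hfv x]
    ring
  rw [e1, integral_sub hint i1]
  linarith

end Mollify

/-! ### The equation for a smooth function of the mollified density. -/

section Identity

variable {E : Type*} [NormedAddCommGroup E] [InnerProductSpace ℝ E] [FiniteDimensional ℝ E]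
  [MeasurableSpace E] [BorelSpace E]

/-- A velocity, an initial density and a density on `(0,T) × E` that are jointly measurable and
integrable, with integrable flux. -/
structure IsTransportData (T : ℝ) (u : ℝ → E → E) (ρ₀ : E → ℝ) (ρ : ℝ → E → ℝ) : Prop where
  measurable_velocity : StronglyMeasurable (Function.uncurry u)
  measurable_density : StronglyMeasurable (Function.uncurry ρ)
  measurable_initial : StronglyMeasurable ρ₀
  integrable_initial : Integrable ρ₀ volume
  integrable_velocity :
    Integrable (Function.uncurry u) ((volume.restrict (Ioo 0 T)).prod volume)
  integrable_density :
    Integrable (Function.uncurry ρ) ((volume.restrict (Ioo 0 T)).prod volume)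
  integrable_flux : Integrable (fun z : ℝ × E => ρ z.1 z.2 • u z.1 z.2)
    ((volume.restrict (Ioo 0 T)).prod volume)

/-- The weak form of the transport equation with all integrals over the whole space. -/
noncomputable def globalForm (T : ℝ) (u : ℝ → E → E) (b₀ : E → ℝ) (b : ℝ → E → ℝ)
    (φ : ℝ × E → ℝ) : ℝ :=
  -(∫ t in Ioo 0 T, ∫ x, b t x * fderiv ℝ φ (t, x) (1, 0)) - (∫ x, b₀ x * φ (0, x))
    + ∫ t in Ioo 0 T, ∫ x, b t x * fderiv ℝ φ (t, x) (0, u t x)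

/-- These test functions extract the mollified equation at the point `x`. The ball condition keeps
the kernel centred at `x` inside `Ω`. -/
theorem isTest_mul_translate {T : ℝ} {Ω : Set E} {η : E → ℝ} {δ : ℝ} {C : ℝ≥0∞}
    (hη : IsMollifier η δ C) {x : E} (hx : closedBall x δ ⊆ Ω) {χ : ℝ → ℝ} (hχ : ContDiff ℝ ∞ χ)
    (hχc : HasCompactSupport χ) (hχT : tsupport χ ⊆ Iio T) :
    IsTest T Ω fun z : ℝ × E => χ z.1 * η (x - z.2) := by
  have hη' := hη.contDiff
  have hsub : tsupport (fun z : ℝ × E => χ z.1 * η (x - z.2)) ⊆ tsupport χ ×ˢ closedBall x δ := by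
    refine closure_minimal (fun z hz => ⟨?_, ?_⟩) ((isClosed_tsupport χ).prod isClosed_closedBall)
    · exact subset_tsupport _ fun h => hz (by simp only; rw [h, zero_mul])
    · by_contra h
      refine hz ?_
      rw [mem_closedBall, dist_comm, dist_eq_norm, not_le] at h
      simp only
      rw [hη.eq_zero h, mul_zero]
  refine ⟨by fun_prop, ?_, hsub.trans (prod_mono hχT hx)⟩
  exact (IsCompact.prod hχc (isCompact_closedBall x δ)).of_isClosed_subset (isClosed_tsupport _)
    hsub

omit [FiniteDimensional ℝ E] [MeasurableSpace E] [BorelSpace E] in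
theorem fderiv_mul_translate {η : E → ℝ} (hη : ContDiff ℝ ∞ η) (x : E) {χ : ℝ → ℝ}
    (hχ : ContDiff ℝ ∞ χ) (t : ℝ) (y : E) (s : ℝ) (w : E) :
    fderiv ℝ (fun z : ℝ × E => χ z.1 * η (x - z.2)) (t, y) (s, w) =
      s * (deriv χ t * η (x - y)) - χ t * fderiv ℝ η (x - y) w := by
  have h1 : HasFDerivAt (fun z : ℝ × E => χ z.1)
      (deriv χ t • ContinuousLinearMap.fst ℝ ℝ E) (t, y) :=
    (((hχ.differentiable (by simp)) t).hasDerivAt).comp_hasFDerivAt (t, y)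
      (ContinuousLinearMap.fst ℝ ℝ E).hasFDerivAt
  have h2 : HasFDerivAt (fun z : ℝ × E => η (x - z.2))
      ((fderiv ℝ η (x - y)).comp (-(ContinuousLinearMap.snd ℝ ℝ E))) (t, y) :=
    (((hη.differentiable (by simp)) (x - y)).hasFDerivAt).comp (t, y)
      ((ContinuousLinearMap.snd ℝ ℝ E).hasFDerivAt.const_sub x)
  rw [(h1.fun_mul h2).fderiv]
  simp
  ring

theorem IsTest.integrable_fderiv_time {T : ℝ} {Ω : Set E} {φ : ℝ × E → ℝ} (hφ : IsTest T Ω φ)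
    (μ : Measure ℝ) [IsFiniteMeasure μ] :
    Integrable (fun z : ℝ × E => fderiv ℝ φ z (1, 0)) (μ.prod volume) := by
  have := hφ.continuous_fderiv
  refine Continuous.integrable_of_hasCompactSupport (by fun_prop) ?_
  exact hφ.hasCompactSupport_fderiv.mono fun z hz h => hz (by simp only; rw [h]; rfl)

theorem IsTest.integrable_initial {T : ℝ} {Ω : Set E} {φ : ℝ × E → ℝ} (hφ : IsTest T Ω φ) :
    Integrable (fun x => φ (0, x)) volume :=
  (hφ.contDiff_space 0).continuous.integrable_of_hasCompactSupport
    (hφ.hasCompactSupport_space 0)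

omit [FiniteDimensional ℝ E] [MeasurableSpace E] [BorelSpace E] in
theorem IsTest.norm_fderiv_velocity_le {φ : ℝ × E → ℝ} {B : ℝ} (hB : ∀ z, ‖fderiv ℝ φ z‖ ≤ B)
    (z : ℝ × E) (w : E) : ‖fderiv ℝ φ z (0, w)‖ ≤ B * ‖w‖ := by
  refine (ContinuousLinearMap.le_opNorm _ _).trans ?_
  have : ‖((0 : ℝ), w)‖ = ‖w‖ := by simp [Prod.norm_def]
  rw [this]
  gcongr
  exact hB z

namespace IsTransportData

variable {T : ℝ} {u : ℝ → E → E} {ρ₀ : E → ℝ} {ρ : ℝ → E → ℝ}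
  {η : E → ℝ} {δ : ℝ} {C : ℝ≥0∞}

theorem stronglyMeasurable_slice_density (H : IsTransportData T u ρ₀ ρ) (t : ℝ) :
    StronglyMeasurable (ρ t) :=
  H.measurable_density.comp_measurable (measurable_const.prodMk measurable_id)

theorem stronglyMeasurable_slice_velocity (H : IsTransportData T u ρ₀ ρ) (t : ℝ) :
    StronglyMeasurable (u t) :=
  H.measurable_velocity.comp_measurable (measurable_const.prodMk measurable_id)

theorem stronglyMeasurable_mollify (H : IsTransportData T u ρ₀ ρ)
    (hη : IsMollifier η δ C) :
    StronglyMeasurable fun z : ℝ × E => mollify η (ρ z.1) z.2 := by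
  have hη' := hη.continuous
  refine StronglyMeasurable.integral_prod_right (f := fun (z : ℝ × E) y => ρ z.1 y * η (z.2 - y)) ?_
  exact (H.measurable_density.comp_measurable
    (by fun_prop : Measurable fun z : (ℝ × E) × E => (z.1.1, z.2))).mul
    (by fun_prop : Continuous fun z : (ℝ × E) × E => η (z.1.2 - z.2)).stronglyMeasurable

theorem stronglyMeasurable_flux (H : IsTransportData T u ρ₀ ρ)
    (hη : IsMollifier η δ C) :
    StronglyMeasurable fun z : ℝ × E => flux η (ρ z.1) (u z.1) z.2 := by
  have hη' := hη.continuous_fderiv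
  refine StronglyMeasurable.integral_prod_right
    (f := fun (z : ℝ × E) y => ρ z.1 y * fderiv ℝ η (z.2 - y) (u z.1 y)) ?_
  refine (H.measurable_density.comp_measurable
    (by fun_prop : Measurable fun z : (ℝ × E) × E => (z.1.1, z.2))).mul ?_
  exact isBoundedBilinearMap_apply.continuous.comp_stronglyMeasurable
    ((by fun_prop : Continuous fun z : (ℝ × E) × E =>
      fderiv ℝ η (z.1.2 - z.2)).stronglyMeasurable.prodMk
      (H.measurable_velocity.comp_measurable
        (by fun_prop : Measurable fun z : (ℝ × E) × E => (z.1.1, z.2))))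

theorem stronglyMeasurable_commutator (H : IsTransportData T u ρ₀ ρ)
    (hη : IsMollifier η δ C) :
    StronglyMeasurable fun z : ℝ × E => commutator η (ρ z.1) (u z.1) z.2 := by
  have hη' := hη.continuous_fderiv
  refine StronglyMeasurable.integral_prod_right
    (f := fun (z : ℝ × E) y => ρ z.1 y * fderiv ℝ η (z.2 - y) (u z.1 y - u z.1 z.2)) ?_
  refine (H.measurable_density.comp_measurable
    (by fun_prop : Measurable fun z : (ℝ × E) × E => (z.1.1, z.2))).mul ?_
  exact isBoundedBilinearMap_apply.continuous.comp_stronglyMeasurable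
    ((by fun_prop : Continuous fun z : (ℝ × E) × E =>
      fderiv ℝ η (z.1.2 - z.2)).stronglyMeasurable.prodMk
      ((H.measurable_velocity.comp_measurable
        (by fun_prop : Measurable fun z : (ℝ × E) × E => (z.1.1, z.2))).sub
        (H.measurable_velocity.comp_measurable measurable_fst)))

theorem stronglyMeasurable_fderiv_velocity (H : IsTransportData T u ρ₀ ρ) {Ω : Set E}
    {φ : ℝ × E → ℝ} (hφ : IsTest T Ω φ) :
    StronglyMeasurable fun z : ℝ × E => fderiv ℝ φ z (0, u z.1 z.2) :=
  isBoundedBilinearMap_apply.continuous.comp_stronglyMeasurable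
    (hφ.continuous_fderiv.stronglyMeasurable.prodMk
      (stronglyMeasurable_const.prodMk H.measurable_velocity))

theorem integrable_fderiv_velocity (H : IsTransportData T u ρ₀ ρ) {Ω : Set E} {φ : ℝ × E → ℝ}
    (hφ : IsTest T Ω φ) :
    Integrable (fun z : ℝ × E => fderiv ℝ φ z (0, u z.1 z.2))
      ((volume.restrict (Ioo 0 T)).prod volume) := by
  obtain ⟨B, -, -, hB⟩ := hφ.exists_bound
  exact (H.integrable_velocity.norm.const_mul B).mono'
    (H.stronglyMeasurable_fderiv_velocity hφ).aestronglyMeasurable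
    (Eventually.of_forall fun z => IsTest.norm_fderiv_velocity_le hB z _)

theorem ae_integrable_slices (H : IsTransportData T u ρ₀ ρ) :
    ∀ᵐ t ∂(volume.restrict (Ioo 0 T)), Integrable (ρ t) volume ∧ Integrable (u t) volume ∧
      Integrable (fun x => ρ t x • u t x) volume := by
  filter_upwards [H.integrable_density.prod_right_ae, H.integrable_velocity.prod_right_ae,
    H.integrable_flux.prod_right_ae] with t h1 h2 h3 using ⟨h1, h2, h3⟩

/-- The mollified equation, weakly in time at each point away from the boundary. -/
theorem mollified_weak {Ω : Set E}
    (hweak : ∀ φ, IsTest T Ω φ → globalForm T u ρ₀ ρ φ = 0) (hη : IsMollifier η δ C) {x : E}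
    (hx : closedBall x δ ⊆ Ω) {χ : ℝ → ℝ} (hχ : ContDiff ℝ ∞ χ)
    (hχc : HasCompactSupport χ) (hχT : tsupport χ ⊆ Iio T) :
    -(∫ t in Ioo 0 T, mollify η (ρ t) x * deriv χ t) - mollify η ρ₀ x * χ 0 =
      ∫ t in Ioo 0 T, χ t * flux η (ρ t) (u t) x := by
  have h := hweak _ (isTest_mul_translate hη hx hχ hχc hχT)
  simp only [globalForm, fderiv_mul_translate hη.contDiff x hχ, map_zero, one_mul, zero_mul, mul_zero,
    sub_zero, zero_sub] at h
  have e1 : ∀ t, ∫ y, ρ t y * (deriv χ t * η (x - y)) = mollify η (ρ t) x * deriv χ t := by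
    intro t
    rw [mollify, ← integral_mul_const]
    congr 1
    ext y
    ring
  have e2 : ∫ y, ρ₀ y * (χ 0 * η (x - y)) = mollify η ρ₀ x * χ 0 := by
    rw [mollify, ← integral_mul_const]
    congr 1
    ext y
    ring
  have e3 : ∀ t, ∫ y, ρ t y * -(χ t * fderiv ℝ η (x - y) (u t y)) =
      -(χ t * flux η (ρ t) (u t) x) := by
    intro t
    rw [flux, ← integral_const_mul, ← integral_neg]
    congr 1
    ext y
    ring
  simp only [e1, e2, e3, integral_neg] at h
  linarith

theorem integrableOn_mollify (H : IsTransportData T u ρ₀ ρ) (hη : IsMollifier η δ C)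
    (x : E) : IntegrableOn (fun t => mollify η (ρ t) x) (Ioo 0 T) := by
  obtain ⟨B, hB, -⟩ := hη.exists_bound
  have hη' := hη.continuous
  exact Integrable.integral_prod_left (f := fun z : ℝ × E => ρ z.1 z.2 * η (x - z.2))
    (H.integrable_density.mul_bdd (by fun_prop) (Eventually.of_forall fun z => hB (x - z.2)))

theorem integrableOn_flux (H : IsTransportData T u ρ₀ ρ) (hη : IsMollifier η δ C)
    (x : E) : IntegrableOn (fun t => flux η (ρ t) (u t) x) (Ioo 0 T) := by
  obtain ⟨B, -, hB⟩ := hη.exists_bound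
  refine Integrable.mono' (H.integrable_flux.norm.integral_prod_left.const_mul B)
    ((H.stronglyMeasurable_flux hη).comp_measurable
      (measurable_id.prodMk measurable_const)).aestronglyMeasurable ?_
  filter_upwards [H.ae_integrable_slices] with t ht
  exact norm_flux_le hB ht.2.2 x

/-- The equation satisfied by a smooth function of the mollified solution, up to the commutator. -/
theorem globalForm_mollify {Ω : Set E} (H : IsTransportData T u ρ₀ ρ) (hT : 0 < T)
    (hweak : ∀ φ, IsTest T Ω φ → globalForm T u ρ₀ ρ φ = 0)
    (hdiv : ∀ᵐ t ∂(volume.restrict (Ioo 0 T)), ∀ φ : E → ℝ, ContDiff ℝ ∞ φ →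
      HasCompactSupport φ → tsupport φ ⊆ Ω → ∫ x, fderiv ℝ φ x (u t x) = 0)
    (hη : IsMollifier η δ C) {φ : ℝ × E → ℝ} (hφ : IsTest T Ω φ)
    (hφδ : ∀ x ∈ Prod.snd '' tsupport φ, closedBall x δ ⊆ Ω)
    {β : ℝ → ℝ} (hβ : ContDiff ℝ ∞ β) {M : ℝ} (hM : ∀ s, ‖β s‖ ≤ M) {K : NNReal}
    (hK : LipschitzWith K β) :
    globalForm T u (fun x => β (mollify η ρ₀ x)) (fun t x => β (mollify η (ρ t) x)) φ =
      ∫ t in Ioo 0 T, ∫ x, φ (t, x) *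
        (deriv β (mollify η (ρ t) x) * commutator η (ρ t) (u t) x) := by
  obtain ⟨B, hB0, hφB, hφB'⟩ := hφ.exists_bound
  obtain ⟨Bη, -, hηB⟩ := hη.exists_bound
  have hφc := hφ.contDiff.continuous
  have hφ1 := hφ.continuous_fderiv
  have hβc := hβ.continuous
  have hβ1 : Continuous (deriv β) := hβ.continuous_deriv (by simp)
  have hβK : ∀ s, ‖deriv β s‖ ≤ K := fun s => norm_deriv_le_of_lipschitz hK
  have hm := H.stronglyMeasurable_mollify hη
  have hfl := H.stronglyMeasurable_flux hη
  set μ : Measure ℝ := volume.restrict (Ioo 0 T) with hμ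
  have hpt : ∀ x, -(∫ t, β (mollify η (ρ t) x) * fderiv ℝ φ (t, x) (1, 0) ∂μ)
      - β (mollify η ρ₀ x) * φ (0, x) =
        ∫ t, φ (t, x) * (deriv β (mollify η (ρ t) x) * flux η (ρ t) (u t) x) ∂μ := by
    intro x
    by_cases hx : x ∈ Prod.snd '' tsupport φ
    -- For fixed `x` the mollified equation is an ordinary differential equation in `t`, tested here
    -- with `φ(·, x)`. This function vanishes at `T` but need not vanish at `0`.
    · have h := weak_chain_rule hT (H.integrableOn_mollify hη x) (H.integrableOn_flux hη x)
        (fun χ h1 h2 h3 => mollified_weak hweak hη (hφδ x hx) h1 h2 h3) (hβ.of_le (by simp)) hK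
        (χ := fun t => φ (t, x)) (by have := hφ.contDiff.of_le (m := 1) (by simp); fun_prop)
        (hφ.apply_final x)
      simpa only [hφ.deriv_time] using h
    · simp [IsTest.eq_zero φ hx, IsTest.fderiv_eq_zero φ hx]
  have I1 : Integrable (fun z : ℝ × E => β (mollify η (ρ z.1) z.2) * fderiv ℝ φ z (1, 0))
      (μ.prod volume) := by
    exact (hφ.integrable_fderiv_time μ).bdd_mul
      (hβc.comp_stronglyMeasurable hm).aestronglyMeasurable (Eventually.of_forall fun z => hM _)
  have I2 : Integrable (fun z : ℝ × E => φ z *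
      (deriv β (mollify η (ρ z.1) z.2) * flux η (ρ z.1) (u z.1) z.2)) (μ.prod volume) := by
    set Kc := Prod.snd '' tsupport φ with hKc
    have hKm : MeasurableSet Kc := hφ.isCompact_image_snd.measurableSet
    have h1 : Integrable (fun t => ∫ y, ‖ρ t y • u t y‖) μ :=
      H.integrable_flux.norm.integral_prod_left
    -- The flux is bounded in `x` by a multiple of `‖ρ(t) u(t)‖_1`, so the majorant is a product of
    -- a function of `t` and a constant on a compact set.
    have h2 : Integrable (Kc.indicator fun _ : E => B * K * Bη) volume :=
      (integrable_indicator_iff hKm).2 (integrableOn_const hφ.isCompact_image_snd.measure_ne_top)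
    refine (h1.mul_prod h2).mono' ?_ ?_
    · exact (hφc.stronglyMeasurable.mul ((hβ1.comp_stronglyMeasurable hm).mul
        hfl)).aestronglyMeasurable
    · have hsl := H.ae_integrable_slices
      have : ∀ᵐ z ∂(μ.prod (volume : Measure E)),
          Integrable (fun x => ρ z.1 x • u z.1 x) volume :=
        Measure.quasiMeasurePreserving_fst.ae (hsl.mono fun t ht => ht.2.2)
      filter_upwards [this] with z hz
      by_cases hzK : z.2 ∈ Kc
      · rw [indicator_of_mem hzK, norm_mul, norm_mul]
        calc ‖φ z‖ * (‖deriv β (mollify η (ρ z.1) z.2)‖ * ‖flux η (ρ z.1) (u z.1) z.2‖)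
            ≤ B * (K * (Bη * ∫ y, ‖ρ z.1 y • u z.1 y‖)) := by
              gcongr
              · exact hφB z
              · exact hβK _
              · exact norm_flux_le hηB hz _
          _ = _ := by ring
      · have := IsTest.eq_zero φ hzK z.1
        rw [indicator_of_notMem hzK, this]
        simp
  have I3 : Integrable (fun z : ℝ × E => β (mollify η (ρ z.1) z.2) *
      fderiv ℝ φ z (0, u z.1 z.2)) (μ.prod volume) := by
    exact (H.integrable_fderiv_velocity hφ).bdd_mul
      (hβc.comp_stronglyMeasurable hm).aestronglyMeasurable (Eventually.of_forall fun z => hM _)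
  have I4 : Integrable (fun x => β (mollify η ρ₀ x) * φ (0, x)) volume := by
    have h2 := (contDiff_mollify hη H.integrable_initial).continuous
    exact (hφ.integrable_initial).bdd_mul (hβc.comp h2).aestronglyMeasurable
      (Eventually.of_forall fun z => hM _)
  have e1 : -(∫ t, (∫ x, β (mollify η (ρ t) x) * fderiv ℝ φ (t, x) (1, 0)) ∂μ)
      - (∫ x, β (mollify η ρ₀ x) * φ (0, x)) =
        ∫ t, (∫ x, φ (t, x) * (deriv β (mollify η (ρ t) x) * flux η (ρ t) (u t) x)) ∂μ := by
    have s1 := integral_integral_swap (f := fun t x => β (mollify η (ρ t) x) *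
      fderiv ℝ φ (t, x) (1, 0)) I1
    have s2 := integral_integral_swap (f := fun t x => φ (t, x) *
      (deriv β (mollify η (ρ t) x) * flux η (ρ t) (u t) x)) I2
    have s3 := integral_sub I1.integral_prod_right.neg I4
    simp only [Pi.neg_apply] at s3
    rw [s1, s2, ← integral_neg, ← s3]
    exact integral_congr_ae (Eventually.of_forall hpt)
  rw [globalForm, e1, ← integral_add I2.integral_prod_left I3.integral_prod_left]
  refine integral_congr_ae ?_
  filter_upwards [H.ae_integrable_slices, hdiv, I2.prod_right_ae] with t ht hdt hI
  have := integral_renormalized_flux hη ht.1 ht.2.1 ht.2.2 hdt hβ (hφ.contDiff_space t)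
    (hφ.hasCompactSupport_space t) ((hφ.tsupport_space_subset t).trans hφ.image_snd_subset) hI
  simpa only [hφ.fderiv_space] using this

end IsTransportData

end Identity

/-! ### Removing the mollification. -/

section Limit

variable {E F : Type*} [NormedAddCommGroup E] [InnerProductSpace ℝ E] [FiniteDimensional ℝ E]
  [MeasurableSpace E] [BorelSpace E] [NormedAddCommGroup F] [NormedSpace ℝ F]
  {p q C M : ℝ≥0∞} {η : ℕ → E → ℝ} {δ : ℕ → ℝ}

theorem tendsto_lintegral_mollify_sub (hpq : p⁻¹ + q⁻¹ = 1) (hq : q ≠ ⊤)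
    (hη : ∀ n, IsMollifier (η n) (δ n) C) (hδ : Tendsto δ atTop (𝓝 0)) {f : E → ℝ} {g : E → F}
    (hfm : StronglyMeasurable f) (hgm : StronglyMeasurable g) (hf1 : Integrable f volume)
    (hf : MemLp f p volume) (hg : MemLp g q volume) :
    Tendsto (fun n => ∫⁻ x, ‖mollify (η n) f x - f x‖ₑ * ‖g x‖ₑ) atTop (𝓝 0) := by
  rw [ENNReal.tendsto_nhds_zero]
  intro ε hε
  obtain ⟨r, hr, h⟩ := exists_forall_lintegral_enorm_translate_smul_sub_le hpq hq hf hg hε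
  filter_upwards [hδ.eventually (ge_mem_nhds hr)] with n hn
  refine lintegral_mollify_sub_smul_le (hη n) hfm hgm hf1 fun a ha => ?_
  simpa using h a 0 (ha.trans hn) (by simpa using hr.le)

theorem lintegral_mollify_sub_le (hpq : p⁻¹ + q⁻¹ = 1) (hη : ∀ n, IsMollifier (η n) (δ n) C)
    {f : E → ℝ} {g : E → F} (hfm : StronglyMeasurable f) (hgm : StronglyMeasurable g)
    (hf1 : Integrable f volume) (n : ℕ) :
    ∫⁻ x, ‖mollify (η n) f x - f x‖ₑ * ‖g x‖ₑ ≤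
      2 * (eLpNorm f p volume * eLpNorm g q volume) := by
  refine lintegral_mollify_sub_smul_le (hη n) hfm hgm hf1 fun a _ => ?_
  simpa using lintegral_enorm_translate_smul_sub_le hpq hfm.aestronglyMeasurable
    hgm.aestronglyMeasurable a 0

namespace IsTransportData

variable {T : ℝ} {u : ℝ → E → E} {ρ₀ : E → ℝ} {ρ : ℝ → E → ℝ}

/-- Convergence holds slice by slice, and `2 M ‖g(t)‖_q` dominates in time. The weight `g` is later
a cut-off for the time-derivative term and a multiple of `u` for the transport term. -/
theorem tendsto_lintegral_prod_mollify_sub (H : IsTransportData T u ρ₀ ρ)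
    (hpq : p⁻¹ + q⁻¹ = 1) (hq : q ≠ ⊤) (hη : ∀ n, IsMollifier (η n) (δ n) C)
    (hδ : Tendsto δ atTop (𝓝 0)) (hM : M ≠ ⊤)
    (hρ : ∀ᵐ t ∂(volume.restrict (Ioo 0 T)), MemLp (ρ t) p volume ∧ eLpNorm (ρ t) p volume ≤ M)
    {g : ℝ → E → F} (hgm : StronglyMeasurable (Function.uncurry g))
    (hg : ∀ᵐ t ∂(volume.restrict (Ioo 0 T)), MemLp (g t) q volume)
    (hgi : ∫⁻ t in Ioo 0 T, eLpNorm (g t) q volume ≠ ⊤) :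
    Tendsto (fun n => ∫⁻ z, ‖mollify (η n) (ρ z.1) z.2 - ρ z.1 z.2‖ₑ * ‖g z.1 z.2‖ₑ
      ∂((volume.restrict (Ioo 0 T)).prod volume)) atTop (𝓝 0) := by
  have hmeas : ∀ n, Measurable fun z : ℝ × E =>
      ‖mollify (η n) (ρ z.1) z.2 - ρ z.1 z.2‖ₑ * ‖g z.1 z.2‖ₑ := fun n =>
    ((H.stronglyMeasurable_mollify (hη n)).sub H.measurable_density).enorm.mul hgm.enorm
  have hgt : ∀ t, StronglyMeasurable (g t) := fun t =>
    hgm.comp_measurable (measurable_const.prodMk measurable_id)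
  simp only [lintegral_prod _ (hmeas _).aemeasurable]
  have := tendsto_lintegral_of_dominated_convergence (μ := volume.restrict (Ioo 0 T))
    (F := fun n t => ∫⁻ x, ‖mollify (η n) (ρ t) x - ρ t x‖ₑ * ‖g t x‖ₑ) (f := fun _ => 0)
    (fun t => 2 * (M * eLpNorm (g t) q volume)) (fun n => (hmeas n).lintegral_prod_right')
    (fun n => ?_) ?_ ?_
  · simpa using this
  · filter_upwards [H.ae_integrable_slices, hρ] with t ht htρ
    refine (lintegral_mollify_sub_le hpq hη (H.stronglyMeasurable_slice_density t) (hgt t)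
      ht.1 n).trans ?_
    gcongr
    exact htρ.2
  · rw [lintegral_const_mul' _ _ (by simp), lintegral_const_mul' _ _ hM]
    exact ENNReal.mul_ne_top (by simp) (ENNReal.mul_ne_top hM hgi)
  · filter_upwards [H.ae_integrable_slices, hρ, hg] with t ht htρ htg
    exact tendsto_lintegral_mollify_sub hpq hq hη hδ (H.stronglyMeasurable_slice_density t)
      (hgt t) ht.1 htρ.1 htg

/-- For almost every `t` the commutator estimate and the translation lemma give convergence, and the
uniform Hölder bound gives the majorant `2 C M ‖G(t)‖_q`. Both apply only once `δ n ≤ r`. -/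
theorem tendsto_lintegral_prod_commutator (H : IsTransportData T u ρ₀ ρ)
    (hpq : p⁻¹ + q⁻¹ = 1) (hq : q ≠ ⊤) (hη : ∀ n, IsMollifier (η n) (δ n) C) (hC : C ≠ ⊤)
    (hδ : Tendsto δ atTop (𝓝 0)) (hM : M ≠ ⊤)
    (hρ : ∀ᵐ t ∂(volume.restrict (Ioo 0 T)), MemLp (ρ t) p volume ∧ eLpNorm (ρ t) p volume ≤ M)
    {Ω U : Set E} (hΩ : IsOpen Ω) (hU : IsOpen U) {r : ℝ} (hr : 0 < r)
    (hUr : ∀ x ∈ U, closedBall x r ⊆ Ω)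
    {G : ℝ → E → E →L[ℝ] E} (hGm : StronglyMeasurable (Function.uncurry G))
    (hG : ∀ᵐ t ∂(volume.restrict (Ioo 0 T)), Integrable (G t) volume ∧ MemLp (G t) q volume)
    (hGi : ∫⁻ t in Ioo 0 T, eLpNorm (G t) q volume ≠ ⊤)
    (hw : ∀ᵐ t ∂(volume.restrict (Ioo 0 T)), ∀ φ : E → ℝ, ContDiff ℝ ∞ φ →
      HasCompactSupport φ → tsupport φ ⊆ Ω → ∀ y,
      ∫ x, fderiv ℝ φ x y • u t x = -∫ x, φ x • G t x y)
    (hdiv : ∀ᵐ t ∂(volume.restrict (Ioo 0 T)), ∀ φ : E → ℝ, ContDiff ℝ ∞ φ →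
      HasCompactSupport φ → tsupport φ ⊆ Ω → ∫ x, fderiv ℝ φ x (u t x) = 0) :
    Tendsto (fun n => ∫⁻ t in Ioo 0 T, ∫⁻ x in U, ‖commutator (η n) (ρ t) (u t) x‖ₑ)
      atTop (𝓝 0) := by
  have hmeas : ∀ n, Measurable fun z : ℝ × E => ‖commutator (η n) (ρ z.1) (u z.1) z.2‖ₑ :=
    fun n => (H.stronglyMeasurable_commutator (hη n)).enorm
  have hGt : ∀ t, StronglyMeasurable (G t) := fun t =>
    hGm.comp_measurable (measurable_const.prodMk measurable_id)
  have key : ∀ᵐ t ∂(volume.restrict (Ioo 0 T)), ∀ n, δ n ≤ r → ∀ ε : ℝ≥0∞,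
      (∀ a b : E, ‖a‖ ≤ δ n → ‖b‖ ≤ δ n →
        ∫⁻ x, ‖ρ t (x - a) • G t (x - b) - ρ t x • G t x‖ₑ ≤ ε) →
      ∫⁻ x in U, ‖commutator (η n) (ρ t) (u t) x‖ₑ ≤ C * ε := by
    filter_upwards [H.ae_integrable_slices, hG, hw, hdiv] with t ht htG htw htd n hn ε hε
    exact lintegral_commutator_le hΩ hU
      (fun x hx => (closedBall_subset_closedBall hn).trans (hUr x hx)) (hη n)
      (H.stronglyMeasurable_slice_density t) (H.stronglyMeasurable_slice_velocity t) (hGt t)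
      ht.1 ht.2.1 htG.1 ht.2.2 htw htd hε
  have hδr := hδ.eventually (ge_mem_nhds hr)
  have := tendsto_lintegral_filter_of_dominated_convergence (μ := volume.restrict (Ioo 0 T))
    (l := atTop) (F := fun n t => ∫⁻ x in U, ‖commutator (η n) (ρ t) (u t) x‖ₑ)
    (f := fun _ => 0) (fun t => C * (2 * (M * eLpNorm (G t) q volume)))
    (Eventually.of_forall fun n => (hmeas n).lintegral_prod_right') ?_ ?_ ?_
  · simpa using this
  · filter_upwards [hδr] with n hn
    filter_upwards [key, hρ] with t ht htρ
    refine (ht n hn _ fun a b _ _ => lintegral_enorm_translate_smul_sub_le hpq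
      (H.stronglyMeasurable_slice_density t).aestronglyMeasurable
      (hGt t).aestronglyMeasurable a b).trans ?_
    gcongr
    exact htρ.2
  · rw [lintegral_const_mul' _ _ hC, lintegral_const_mul' _ _ (by simp),
      lintegral_const_mul' _ _ hM]
    exact ENNReal.mul_ne_top hC (ENNReal.mul_ne_top (by simp) (ENNReal.mul_ne_top hM hGi))
  · filter_upwards [key, hρ, hG] with t ht htρ htG
    rw [ENNReal.tendsto_nhds_zero]
    intro ε hε
    -- Dividing by `C + 1` avoids a case distinction for `C = 0`.
    have hε' : 0 < ε / (C + 1) := ENNReal.div_pos hε.ne' (by simp [hC])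
    obtain ⟨r', hr', h⟩ :=
      exists_forall_lintegral_enorm_translate_smul_sub_le hpq hq htρ.1 htG.2 hε'
    filter_upwards [hδr, hδ.eventually (ge_mem_nhds hr')] with n hn hn'
    refine (ht n hn _ fun a b ha hb => h a b (ha.trans hn') (hb.trans hn')).trans ?_
    calc C * (ε / (C + 1)) ≤ (C + 1) * (ε / (C + 1)) := by gcongr; exact le_self_add
      _ ≤ ε := ENNReal.mul_div_le

theorem globalForm_eq_integral_prod {b₀ : E → ℝ} {b : ℝ → E → ℝ} {φ : ℝ × E → ℝ}
    (h1 : Integrable (fun z : ℝ × E => b z.1 z.2 * fderiv ℝ φ z (1, 0)) ((volume.restrict (Ioo 0 T)).prod volume))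
    (h2 : Integrable (fun z : ℝ × E => b z.1 z.2 * fderiv ℝ φ z (0, u z.1 z.2))
      ((volume.restrict (Ioo 0 T)).prod volume)) :
    globalForm T u b₀ b φ =
      -(∫ z, b z.1 z.2 * fderiv ℝ φ z (1, 0) ∂((volume.restrict (Ioo 0 T)).prod volume))
        - (∫ x, b₀ x * φ (0, x))
        + ∫ z, b z.1 z.2 * fderiv ℝ φ z (0, u z.1 z.2)
          ∂((volume.restrict (Ioo 0 T)).prod volume) := by
  rw [globalForm, integral_prod _ h1, integral_prod _ h2]

/-- Convergence of the weak form along mollifications of the density. -/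
theorem tendsto_globalForm_mollify (H : IsTransportData T u ρ₀ ρ)
    (hpq : p⁻¹ + q⁻¹ = 1) (hq : q ≠ ⊤) (hη : ∀ n, IsMollifier (η n) (δ n) C)
    (hδ : Tendsto δ atTop (𝓝 0)) (hM : M ≠ ⊤)
    (hρ : ∀ᵐ t ∂(volume.restrict (Ioo 0 T)), MemLp (ρ t) p volume ∧ eLpNorm (ρ t) p volume ≤ M)
    (hρ₀ : MemLp ρ₀ p volume)
    (hu : ∀ᵐ t ∂(volume.restrict (Ioo 0 T)), MemLp (u t) q volume)
    (hui : ∫⁻ t in Ioo 0 T, eLpNorm (u t) q volume ≠ ⊤)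
    {Ω : Set E} {φ : ℝ × E → ℝ} (hφ : IsTest T Ω φ)
    {β : ℝ → ℝ} {M' : ℝ} (hM' : ∀ s, ‖β s‖ ≤ M') {K : NNReal} (hK : LipschitzWith K β) :
    Tendsto (fun n => globalForm T u (fun x => β (mollify (η n) ρ₀ x))
        (fun t x => β (mollify (η n) (ρ t) x)) φ) atTop
      (𝓝 (globalForm T u (fun x => β (ρ₀ x)) (fun t x => β (ρ t x)) φ)) := by
  obtain ⟨B, hB0, hφB, hφB'⟩ := hφ.exists_bound
  have hφ1 := hφ.continuous_fderiv
  have hβc := hK.continuous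
  set μ : Measure ℝ := volume.restrict (Ioo 0 T) with hμ
  set Kc := Prod.snd '' tsupport φ with hKc
  have hKm : MeasurableSet Kc := hφ.isCompact_image_snd.measurableSet
  have hKv : volume Kc ≠ ⊤ := hφ.isCompact_image_snd.measure_ne_top
  have hKt : volume Kc < ⊤ := hKv.lt_top
  -- A common `L^q` majorant of `φ` and `∂_t φ`, independent of time; it is the weight in the first
  -- two limits.
  set k : E → ℝ := Kc.indicator fun _ => B with hk
  have hkm : StronglyMeasurable k := stronglyMeasurable_const.indicator hKm
  have hkq : MemLp k q volume := memLp_indicator_const q hKm B (Or.inr hKv)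
  have hφk : ∀ t x, ‖φ (t, x)‖ ≤ ‖k x‖ := by
    intro t x
    by_cases hx : x ∈ Kc
    · rw [hk, indicator_of_mem hx, Real.norm_of_nonneg hB0]; exact hφB _
    · rw [IsTest.eq_zero φ hx]; simp
  have hφtk : ∀ t x, ‖fderiv ℝ φ (t, x) (1, 0)‖ ≤ ‖k x‖ := by
    intro t x
    by_cases hx : x ∈ Kc
    · rw [hk, indicator_of_mem hx, Real.norm_of_nonneg hB0]
      refine (ContinuousLinearMap.le_opNorm _ _).trans ?_
      have : ‖((1 : ℝ), (0 : E))‖ = 1 := by simp [Prod.norm_def]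
      rw [this, mul_one]
      exact hφB' _
    · rw [IsTest.fderiv_eq_zero φ hx]; simp
  have hm := fun n => H.stronglyMeasurable_mollify (hη n)
  have I1 : ∀ b : ℝ × E → ℝ, StronglyMeasurable b → Integrable (fun z =>
      β (b z) * fderiv ℝ φ z (1, 0)) (μ.prod volume) := fun b hb =>
    (hφ.integrable_fderiv_time μ).bdd_mul (hβc.comp_stronglyMeasurable hb).aestronglyMeasurable
      (Eventually.of_forall fun z => hM' _)
  have I3 : ∀ b : ℝ × E → ℝ, StronglyMeasurable b → Integrable (fun z =>
      β (b z) * fderiv ℝ φ z (0, u z.1 z.2)) (μ.prod volume) := fun b hb =>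
    (H.integrable_fderiv_velocity hφ).bdd_mul
      (hβc.comp_stronglyMeasurable hb).aestronglyMeasurable (Eventually.of_forall fun z => hM' _)
  have I2 : ∀ b : E → ℝ, StronglyMeasurable b → Integrable (fun x => β (b x) * φ (0, x))
      volume := fun b hb =>
    hφ.integrable_initial.bdd_mul (hβc.comp_stronglyMeasurable hb).aestronglyMeasurable
      (Eventually.of_forall fun z => hM' _)
  have hm0 : ∀ n, StronglyMeasurable (mollify (η n) ρ₀) := fun n =>
    (contDiff_mollify (hη n) H.integrable_initial).continuous.stronglyMeasurable
  have hbd : ∀ (a b c : ℝ) {d : ℝ≥0∞}, ‖c‖ₑ ≤ d →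
      ‖β a * c - β b * c‖ₑ ≤ K * (‖a - b‖ₑ * d) := by
    intro a b c d hcd
    rw [← sub_mul, enorm_mul, ← mul_assoc]
    gcongr
    rw [← edist_eq_enorm_sub, ← edist_eq_enorm_sub]
    exact hK a b
  have hmul : ∀ {f : ℕ → ℝ≥0∞}, Tendsto f atTop (𝓝 0) →
      Tendsto (fun n => (K : ℝ≥0∞) * f n) atTop (𝓝 0) := fun hf => by
    simpa using ENNReal.Tendsto.const_mul hf (Or.inr ENNReal.coe_ne_top)
  have T1 : Tendsto (fun n => ∫ z, β (mollify (η n) (ρ z.1) z.2) * fderiv ℝ φ z (1, 0)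
      ∂(μ.prod volume)) atTop
      (𝓝 (∫ z, β (ρ z.1 z.2) * fderiv ℝ φ z (1, 0) ∂(μ.prod volume))) := by
    refine tendsto_integral_of_L1 _ (I1 _ H.measurable_density).1
      (Eventually.of_forall fun n => I1 _ (hm n)) ?_
    have := H.tendsto_lintegral_prod_mollify_sub hpq hq hη hδ hM hρ (g := fun _ => k)
      (hkm.comp_measurable measurable_snd) (Eventually.of_forall fun _ => hkq) (by
        rw [lintegral_const]
        exact ENNReal.mul_ne_top hkq.eLpNorm_ne_top (by simp))
    refine tendsto_of_tendsto_of_tendsto_of_le_of_le tendsto_const_nhds (hmul this)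
      (fun _ => zero_le) fun n => ?_
    simp only
    rw [← lintegral_const_mul' _ _ ENNReal.coe_ne_top]
    exact lintegral_mono fun z => hbd _ _ _ (enorm_le_iff_norm_le.2 (hφtk z.1 z.2))
  have T2 : Tendsto (fun n => ∫ x, β (mollify (η n) ρ₀ x) * φ (0, x)) atTop
      (𝓝 (∫ x, β (ρ₀ x) * φ (0, x))) := by
    refine tendsto_integral_of_L1 _ (I2 _ H.measurable_initial).1
      (Eventually.of_forall fun n => I2 _ (hm0 n)) ?_
    have := tendsto_lintegral_mollify_sub hpq hq hη hδ H.measurable_initial hkm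
      H.integrable_initial hρ₀ hkq
    refine tendsto_of_tendsto_of_tendsto_of_le_of_le tendsto_const_nhds (hmul this)
      (fun _ => zero_le) fun n => ?_
    simp only
    rw [← lintegral_const_mul' _ _ ENNReal.coe_ne_top]
    exact lintegral_mono fun x => hbd _ _ _ (enorm_le_iff_norm_le.2 (hφk 0 x))
  have T3 : Tendsto (fun n => ∫ z, β (mollify (η n) (ρ z.1) z.2) * fderiv ℝ φ z (0, u z.1 z.2)
      ∂(μ.prod volume)) atTop
      (𝓝 (∫ z, β (ρ z.1 z.2) * fderiv ℝ φ z (0, u z.1 z.2) ∂(μ.prod volume))) := by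
    refine tendsto_integral_of_L1 _ (I3 _ H.measurable_density).1
      (Eventually.of_forall fun n => I3 _ (hm n)) ?_
    have := H.tendsto_lintegral_prod_mollify_sub hpq hq hη hδ hM hρ (g := fun t x => B • u t x)
      (H.measurable_velocity.const_smul B) (hu.mono fun t ht => ht.const_smul B) (by
        simp only [← Pi.smul_def, eLpNorm_const_smul]
        rw [lintegral_const_mul' _ _ (by simp)]
        exact ENNReal.mul_ne_top (by simp) hui)
    refine tendsto_of_tendsto_of_tendsto_of_le_of_le tendsto_const_nhds (hmul this)
      (fun _ => zero_le) fun n => ?_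
    simp only
    rw [← lintegral_const_mul' _ _ ENNReal.coe_ne_top]
    refine lintegral_mono fun z => hbd _ _ _ (enorm_le_iff_norm_le.2 ?_)
    rw [norm_smul, Real.norm_of_nonneg hB0]
    exact IsTest.norm_fderiv_velocity_le hφB' z _
  have e := fun n => globalForm_eq_integral_prod (T := T) (u := u)
    (b₀ := fun x => β (mollify (η n) ρ₀ x)) (b := fun t x => β (mollify (η n) (ρ t) x))
    (I1 _ (hm n)) (I3 _ (hm n))
  simp only [e]
  rw [globalForm_eq_integral_prod (T := T) (u := u) (b := fun t x => β (ρ t x))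
    (I1 _ H.measurable_density) (I3 _ H.measurable_density)]
  exact (T1.neg.sub T2).add T3

/-- Smooth bounded Lipschitz functions of a weak solution are weak solutions when the velocity is
a divergence free Sobolev field. -/
theorem globalForm_renormalized (H : IsTransportData T u ρ₀ ρ) (hT : 0 < T)
    (hpq : p⁻¹ + q⁻¹ = 1) (hq : q ≠ ⊤) (hM : M ≠ ⊤)
    (hρ : ∀ᵐ t ∂(volume.restrict (Ioo 0 T)), MemLp (ρ t) p volume ∧ eLpNorm (ρ t) p volume ≤ M)
    (hρ₀ : MemLp ρ₀ p volume)
    (hu : ∀ᵐ t ∂(volume.restrict (Ioo 0 T)), MemLp (u t) q volume)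
    (hui : ∫⁻ t in Ioo 0 T, eLpNorm (u t) q volume ≠ ⊤)
    {Ω : Set E} (hΩ : IsOpen Ω)
    {G : ℝ → E → E →L[ℝ] E} (hGm : StronglyMeasurable (Function.uncurry G))
    (hG : ∀ᵐ t ∂(volume.restrict (Ioo 0 T)), Integrable (G t) volume ∧ MemLp (G t) q volume)
    (hGi : ∫⁻ t in Ioo 0 T, eLpNorm (G t) q volume ≠ ⊤)
    (hw : ∀ᵐ t ∂(volume.restrict (Ioo 0 T)), ∀ φ : E → ℝ, ContDiff ℝ ∞ φ →
      HasCompactSupport φ → tsupport φ ⊆ Ω → ∀ y,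
      ∫ x, fderiv ℝ φ x y • u t x = -∫ x, φ x • G t x y)
    (hdiv : ∀ᵐ t ∂(volume.restrict (Ioo 0 T)), ∀ φ : E → ℝ, ContDiff ℝ ∞ φ →
      HasCompactSupport φ → tsupport φ ⊆ Ω → ∫ x, fderiv ℝ φ x (u t x) = 0)
    (hweak : ∀ φ, IsTest T Ω φ → globalForm T u ρ₀ ρ φ = 0)
    {φ : ℝ × E → ℝ} (hφ : IsTest T Ω φ)
    {β : ℝ → ℝ} (hβ : ContDiff ℝ ∞ β) {M' : ℝ} (hM' : ∀ s, ‖β s‖ ≤ M') {K : NNReal}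
    (hK : LipschitzWith K β) :
    globalForm T u (fun x => β (ρ₀ x)) (fun t x => β (ρ t x)) φ = 0 := by
  obtain ⟨C, hC, hmol⟩ := exists_isMollifier E
  set δ : ℕ → ℝ := fun n => 1 / ((n : ℝ) + 1) with hδdef
  have hδ : Tendsto δ atTop (𝓝 0) := tendsto_one_div_add_atTop_nhds_zero_nat
  choose η hη using fun n : ℕ => hmol (δ n) (by positivity)
  have h1 := H.tendsto_globalForm_mollify hpq hq hη hδ hM hρ hρ₀ hu hui hφ hM' hK
  obtain ⟨B, hB0, hφB, -⟩ := hφ.exists_bound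
  set Kc := Prod.snd '' tsupport φ with hKc
  obtain ⟨s, hs, hsΩ⟩ :=
    hφ.isCompact_image_snd.exists_cthickening_subset_open hΩ hφ.image_snd_subset
  -- Half of the admissible thickening is spent on the neighbourhood `U` of the support, half on the
  -- balls around its points.
  set r := s / 2 with hr
  have hr0 : 0 < r := by positivity
  set U := thickening r Kc with hU
  have hUr : ∀ x ∈ U, closedBall x r ⊆ Ω := by
    intro x hx y hy
    obtain ⟨z, hz, hxz⟩ := mem_thickening_iff.1 hx
    refine hsΩ (thickening_subset_cthickening _ _ (mem_thickening_iff.2 ⟨z, hz, ?_⟩))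
    have := dist_triangle y x z
    rw [mem_closedBall] at hy
    linarith
  have hKU : Kc ⊆ U := self_subset_thickening hr0 _
  have h2 := H.tendsto_lintegral_prod_commutator hpq hq hη hC hδ hM hρ hΩ isOpen_thickening hr0
    hUr hGm hG hGi hw hdiv
  have h3 : Tendsto (fun n => globalForm T u (fun x => β (mollify (η n) ρ₀ x))
        (fun t x => β (mollify (η n) (ρ t) x)) φ) atTop (𝓝 0) := by
    rw [tendsto_zero_iff_enorm_tendsto_zero]
    have h4 : Tendsto (fun n => ENNReal.ofReal (B * K) *
        ∫⁻ t in Ioo 0 T, ∫⁻ x in U, ‖commutator (η n) (ρ t) (u t) x‖ₑ) atTop (𝓝 0) := by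
      simpa using ENNReal.Tendsto.const_mul h2 (Or.inr ENNReal.ofReal_ne_top)
    refine tendsto_of_tendsto_of_tendsto_of_le_of_le' tendsto_const_nhds h4
      (Eventually.of_forall fun _ => zero_le) ?_
    filter_upwards [hδ.eventually (ge_mem_nhds hr0)] with n hn
    rw [H.globalForm_mollify hT hweak hdiv (hη n) hφ (fun x hx =>
      (closedBall_subset_closedBall hn).trans (hUr x (hKU hx))) hβ hM' hK]
    refine (enorm_integral_le_lintegral_enorm _).trans ?_
    rw [← lintegral_const_mul' _ _ ENNReal.ofReal_ne_top]
    refine lintegral_mono fun t => ?_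
    refine (enorm_integral_le_lintegral_enorm _).trans ?_
    rw [← lintegral_const_mul' _ _ ENNReal.ofReal_ne_top,
      ← lintegral_indicator isOpen_thickening.measurableSet]
    refine lintegral_mono fun x => ?_
    by_cases hx : x ∈ Kc
    · rw [indicator_of_mem (hKU hx), ← mul_assoc, enorm_mul]
      gcongr
      rw [← ofReal_norm, norm_mul]
      gcongr
      · exact hφB _
      · exact norm_deriv_le_of_lipschitz hK
    · rw [IsTest.eq_zero φ hx]
      simp
  exact tendsto_nhds_unique h1 h3

end IsTransportData

end Limit

/-! ### Approximation of the nonlinearities. -/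

section Approximation

/-- Bounded Lipschitz functions are pointwise limits of smooth ones with the same bounds. -/
theorem exists_smooth_approx {β : ℝ → ℝ} {M : ℝ} (hM : ∀ s, ‖β s‖ ≤ M) {K : NNReal}
    (hK : LipschitzWith K β) :
    ∃ b : ℕ → ℝ → ℝ, (∀ n, ContDiff ℝ ∞ (b n)) ∧ (∀ n s, ‖b n s‖ ≤ M) ∧
      (∀ n, LipschitzWith K (b n)) ∧ ∀ s, Tendsto (fun n => b n s) atTop (𝓝 (β s)) := by
  obtain ⟨C, -, hmol⟩ := exists_isMollifier ℝ
  set δ : ℕ → ℝ := fun n => 1 / ((n : ℝ) + 1) with hδdef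
  have hδ : Tendsto δ atTop (𝓝 0) := tendsto_one_div_add_atTop_nhds_zero_nat
  choose η hη using fun n : ℕ => hmol (δ n) (by positivity)
  have hβc := hK.continuous
  have e1 : ∀ n s, mollify (η n) β s = ∫ w, β (s - w) * η n w := by
    intro n s
    rw [mollify, ← integral_sub_left_eq_self (fun y => β y * η n (s - y)) volume s]
    simp
  have i1 : ∀ n s, Integrable (fun w => β (s - w) * η n w) volume := fun n s =>
    (hη n).integrable.bdd_mul (by fun_prop) (Eventually.of_forall fun w => hM _)
  have hη1 : ∀ n (c : ℝ), ∫ w, c * η n w = c := fun n c => by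
    rw [integral_const_mul, (hη n).integral_eq_one, mul_one]
  refine ⟨fun n => mollify (η n) β, fun n => ?_, fun n s => ?_, fun n => ?_, fun s => ?_⟩
  · simp only [mollify_eq_convolution]
    exact (hη n).hasCompactSupport.contDiff_convolution_right _ hβc.locallyIntegrable
      (hη n).contDiff
  · simp only [e1]
    rw [← hη1 n M]
    refine norm_integral_le_of_norm_le ((hη n).integrable.const_mul M)
      (Eventually.of_forall fun w => ?_)
    rw [norm_mul, Real.norm_of_nonneg ((hη n).nonneg w)]
    exact mul_le_mul_of_nonneg_right (hM _) ((hη n).nonneg w)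
  · refine LipschitzWith.of_dist_le_mul fun s t => ?_
    simp only [e1]
    -- Writing the target constant as its own average against the kernel reduces each estimate to a
    -- pointwise one under the integral.
    rw [dist_eq_norm, ← integral_sub (i1 n s) (i1 n t), ← hη1 n (K * dist s t)]
    refine norm_integral_le_of_norm_le ((hη n).integrable.const_mul _)
      (Eventually.of_forall fun w => ?_)
    rw [← sub_mul, norm_mul, Real.norm_of_nonneg ((hη n).nonneg w), ← dist_eq_norm]
    refine mul_le_mul_of_nonneg_right ?_ ((hη n).nonneg w)
    simpa using hK.dist_le_mul (s - w) (t - w)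
  · rw [tendsto_iff_dist_tendsto_zero]
    have h0 : Tendsto (fun n => K * δ n) atTop (𝓝 0) := by simpa using hδ.const_mul (K : ℝ)
    refine squeeze_zero (fun _ => dist_nonneg) (fun n => ?_) h0
    have i2 : Integrable (fun w => β s * η n w) volume := (hη n).integrable.const_mul _
    have e2 : (∫ w, β (s - w) * η n w) - β s = ∫ w, (β (s - w) * η n w - β s * η n w) := by
      rw [integral_sub (i1 n s) i2, hη1]
    simp only [e1]
    rw [dist_eq_norm, e2, ← hη1 n (K * δ n)]
    refine norm_integral_le_of_norm_le ((hη n).integrable.const_mul _)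
      (Eventually.of_forall fun w => ?_)
    rw [← sub_mul, norm_mul, Real.norm_of_nonneg ((hη n).nonneg w), ← dist_eq_norm]
    rcases le_or_gt ‖w‖ (δ n) with hw | hw
    · refine mul_le_mul_of_nonneg_right ?_ ((hη n).nonneg w)
      refine (hK.dist_le_mul (s - w) s).trans ?_
      gcongr
      simpa [dist_eq_norm] using hw
    · rw [(hη n).eq_zero hw, mul_zero, mul_zero]

/-- These bounded truncations of the identity have derivative at most one and recover the weak
formulation as `k → ∞`; `k + 1` keeps the scale positive. -/
theorem isAdmissible_arctan (k : ℕ) :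
    IsAdmissible fun s => ((k : ℝ) + 1) * Real.arctan (s / ((k : ℝ) + 1)) := by
  have hk : 0 < (k : ℝ) + 1 := by positivity
  refine ⟨contDiff_const.mul (Real.contDiff_arctan.comp (contDiff_id.div_const _)), ⟨((k : ℝ) + 1) * (Real.pi / 2), fun s => ?_⟩, ⟨1, fun s => ?_⟩⟩
  · rw [abs_mul, abs_of_pos hk]
    gcongr
    rw [abs_le]
    exact ⟨(Real.neg_pi_div_two_lt_arctan _).le, (Real.arctan_lt_pi_div_two _).le⟩
  · have h : HasDerivAt (fun s => ((k : ℝ) + 1) * Real.arctan (s / ((k : ℝ) + 1)))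
        (((k : ℝ) + 1) * (1 / (1 + (s / ((k : ℝ) + 1)) ^ 2) * (1 / ((k : ℝ) + 1)))) s :=
      (((hasDerivAt_id s).div_const _).arctan).const_mul _
    rw [h.deriv]
    have e : ((k : ℝ) + 1) * (1 / (1 + (s / ((k : ℝ) + 1)) ^ 2) * (1 / ((k : ℝ) + 1))) =
        1 / (1 + (s / ((k : ℝ) + 1)) ^ 2) := by field_simp
    rw [e, abs_of_pos (by positivity), div_le_one (by positivity)]
    nlinarith [sq_nonneg (s / ((k : ℝ) + 1))]

theorem abs_arctan_le_abs (x : ℝ) : |Real.arctan x| ≤ |x| := by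
  have h := Convex.norm_image_sub_le_of_norm_hasDerivWithin_le (f := Real.arctan) (C := 1)
    (s := univ) (x := 0) (y := x) (fun y _ => (Real.hasDerivAt_arctan y).hasDerivWithinAt)
    (fun y _ => by
      rw [Real.norm_of_nonneg (by positivity), div_le_one (by positivity)]
      nlinarith [sq_nonneg y]) convex_univ (mem_univ _) (mem_univ _)
  simpa using h

/-- The sequence consists of difference quotients of `t ↦ arctan (s t)` at `0` with step `1/(k+1)`.
-/
theorem tendsto_mul_arctan_div (s : ℝ) :
    Tendsto (fun k : ℕ => ((k : ℝ) + 1) * Real.arctan (s / ((k : ℝ) + 1))) atTop (𝓝 s) := by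
  have h : HasDerivAt (fun t : ℝ => Real.arctan (s * t)) s 0 := by
    have := ((hasDerivAt_id (0 : ℝ)).const_mul s).arctan
    simpa using this
  rw [hasDerivAt_iff_tendsto_slope_zero] at h
  have h2 : Tendsto (fun k : ℕ => 1 / ((k : ℝ) + 1)) atTop (𝓝[≠] 0) :=
    tendsto_nhdsWithin_iff.2 ⟨tendsto_one_div_add_atTop_nhds_zero_nat,
      Eventually.of_forall fun k => by
        have : (0 : ℝ) < 1 / ((k : ℝ) + 1) := by positivity
        exact this.ne'⟩
  refine (h.comp h2).congr fun k => ?_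
  simp [div_eq_mul_inv]

end Approximation

/-! ### Passage to the limit in the nonlinearity. -/

section DominatedLimit

variable {E : Type*} [NormedAddCommGroup E] [InnerProductSpace ℝ E] [FiniteDimensional ℝ E]
  [MeasurableSpace E] [BorelSpace E]
  {T : ℝ} {u : ℝ → E → E} {ρ₀ : E → ℝ} {ρ : ℝ → E → ℝ}

/-- The weak form vanishes for dominated pointwise limits of nonlinearities. -/
theorem IsTransportData.globalForm_eq_zero_of_tendsto (H : IsTransportData T u ρ₀ ρ) {Ω : Set E}
    {φ : ℝ × E → ℝ} (hφ : IsTest T Ω φ) {b : ℕ → ℝ → ℝ} {β : ℝ → ℝ}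
    (hb : ∀ n, Continuous (b n)) (hβ : Continuous β) {A : ℝ}
    (hA : ∀ n s, ‖b n s‖ ≤ A + ‖s‖) (hlim : ∀ s, Tendsto (fun n => b n s) atTop (𝓝 (β s)))
    (hz : ∀ n, globalForm T u (fun x => b n (ρ₀ x)) (fun t x => b n (ρ t x)) φ = 0) :
    globalForm T u (fun x => β (ρ₀ x)) (fun t x => β (ρ t x)) φ = 0 := by
  obtain ⟨B, hB0, hφB, hφB'⟩ := hφ.exists_bound
  have hφc := hφ.contDiff.continuous
  have hφ1 := hφ.continuous_fderiv
  set μ : Measure ℝ := volume.restrict (Ioo 0 T) with hμ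
  have hAβ : ∀ s, ‖β s‖ ≤ A + ‖s‖ := fun s =>
    le_of_tendsto (hlim s).norm (Eventually.of_forall fun n => hA n s)
  have hm := H.measurable_density
  have d1 : Integrable (fun z : ℝ × E => A * ‖fderiv ℝ φ z (1, 0)‖ + B * ‖ρ z.1 z.2‖)
      (μ.prod volume) :=
    ((hφ.integrable_fderiv_time μ).norm.const_mul A).add (H.integrable_density.norm.const_mul B)
  have d2 : Integrable (fun x => A * ‖φ (0, x)‖ + B * ‖ρ₀ x‖) volume :=
    (hφ.integrable_initial.norm.const_mul A).add (H.integrable_initial.norm.const_mul B)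
  -- The growth bound `A + ‖s‖` splits the majorant into an integrable velocity term and the
  -- integrable flux `ρ u`. It covers both bounded `β` and the arctan truncations.
  have d3 : Integrable (fun z : ℝ × E => A * ‖fderiv ℝ φ z (0, u z.1 z.2)‖ +
      B * ‖ρ z.1 z.2 • u z.1 z.2‖) (μ.prod volume) :=
    ((H.integrable_fderiv_velocity hφ).norm.const_mul A).add (H.integrable_flux.norm.const_mul B)
  have bd1 : ∀ (c : ℝ → ℝ), (∀ s, ‖c s‖ ≤ A + ‖s‖) → ∀ z : ℝ × E,
      ‖c (ρ z.1 z.2) * fderiv ℝ φ z (1, 0)‖ ≤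
        A * ‖fderiv ℝ φ z (1, 0)‖ + B * ‖ρ z.1 z.2‖ := by
    intro c hc z
    have h1 : ‖fderiv ℝ φ z (1, 0)‖ ≤ B := by
      refine (ContinuousLinearMap.le_opNorm _ _).trans ?_
      have : ‖((1 : ℝ), (0 : E))‖ = 1 := by simp [Prod.norm_def]
      rw [this, mul_one]
      exact hφB' z
    rw [norm_mul]
    have h2 := mul_le_mul_of_nonneg_right (hc (ρ z.1 z.2)) (norm_nonneg (fderiv ℝ φ z (1, 0)))
    have h3 := mul_le_mul_of_nonneg_left h1 (norm_nonneg (ρ z.1 z.2))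
    linarith
  have bd2 : ∀ (c : ℝ → ℝ), (∀ s, ‖c s‖ ≤ A + ‖s‖) → ∀ x : E,
      ‖c (ρ₀ x) * φ (0, x)‖ ≤ A * ‖φ (0, x)‖ + B * ‖ρ₀ x‖ := by
    intro c hc x
    rw [norm_mul]
    have h2 := mul_le_mul_of_nonneg_right (hc (ρ₀ x)) (norm_nonneg (φ (0, x)))
    have h3 := mul_le_mul_of_nonneg_left (hφB (0, x)) (norm_nonneg (ρ₀ x))
    linarith
  have bd3 : ∀ (c : ℝ → ℝ), (∀ s, ‖c s‖ ≤ A + ‖s‖) → ∀ z : ℝ × E,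
      ‖c (ρ z.1 z.2) * fderiv ℝ φ z (0, u z.1 z.2)‖ ≤
        A * ‖fderiv ℝ φ z (0, u z.1 z.2)‖ + B * ‖ρ z.1 z.2 • u z.1 z.2‖ := by
    intro c hc z
    rw [norm_mul, norm_smul]
    have h2 := mul_le_mul_of_nonneg_right (hc (ρ z.1 z.2))
      (norm_nonneg (fderiv ℝ φ z (0, u z.1 z.2)))
    have h3 := mul_le_mul_of_nonneg_left (IsTest.norm_fderiv_velocity_le hφB' z (u z.1 z.2))
      (norm_nonneg (ρ z.1 z.2))
    linarith
  have m1 : ∀ c : ℝ → ℝ, Continuous c → AEStronglyMeasurable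
      (fun z : ℝ × E => c (ρ z.1 z.2) * fderiv ℝ φ z (1, 0)) (μ.prod volume) := fun c hc =>
    ((hc.comp_stronglyMeasurable hm).mul
      (by fun_prop : Continuous fun z => fderiv ℝ φ z (1, 0)).stronglyMeasurable).aestronglyMeasurable
  have m2 : ∀ c : ℝ → ℝ, Continuous c → AEStronglyMeasurable
      (fun x : E => c (ρ₀ x) * φ (0, x)) volume := fun c hc =>
    ((hc.comp_stronglyMeasurable H.measurable_initial).mul
      (hφ.contDiff_space 0).continuous.stronglyMeasurable).aestronglyMeasurable
  have m3 : ∀ c : ℝ → ℝ, Continuous c → AEStronglyMeasurable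
      (fun z : ℝ × E => c (ρ z.1 z.2) * fderiv ℝ φ z (0, u z.1 z.2)) (μ.prod volume) :=
    fun c hc => ((hc.comp_stronglyMeasurable hm).mul
      (H.stronglyMeasurable_fderiv_velocity hφ)).aestronglyMeasurable
  have eq : ∀ c : ℝ → ℝ, Continuous c → (∀ s, ‖c s‖ ≤ A + ‖s‖) →
      globalForm T u (fun x => c (ρ₀ x)) (fun t x => c (ρ t x)) φ =
        -(∫ z, c (ρ z.1 z.2) * fderiv ℝ φ z (1, 0) ∂(μ.prod volume))
        - (∫ x, c (ρ₀ x) * φ (0, x))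
        + ∫ z, c (ρ z.1 z.2) * fderiv ℝ φ z (0, u z.1 z.2) ∂(μ.prod volume) := fun c hc hcA =>
    IsTransportData.globalForm_eq_integral_prod (b := fun t x => c (ρ t x))
      (d1.mono' (m1 c hc) (Eventually.of_forall (bd1 c hcA)))
      (d3.mono' (m3 c hc) (Eventually.of_forall (bd3 c hcA)))
  have T1 := tendsto_integral_of_dominated_convergence _ (fun n => m1 (b n) (hb n)) d1
    (fun n => Eventually.of_forall (bd1 (b n) (hA n)))
    (Eventually.of_forall fun z => (hlim (ρ z.1 z.2)).mul_const (fderiv ℝ φ z (1, 0)))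
  have T2 := tendsto_integral_of_dominated_convergence _ (fun n => m2 (b n) (hb n)) d2
    (fun n => Eventually.of_forall (bd2 (b n) (hA n)))
    (Eventually.of_forall fun x => (hlim (ρ₀ x)).mul_const (φ (0, x)))
  have T3 := tendsto_integral_of_dominated_convergence _ (fun n => m3 (b n) (hb n)) d3
    (fun n => Eventually.of_forall (bd3 (b n) (hA n)))
    (Eventually.of_forall fun z => (hlim (ρ z.1 z.2)).mul_const (fderiv ℝ φ z (0, u z.1 z.2)))
  have hT := (T1.neg.sub T2).add T3
  rw [← eq β hβ hAβ] at hT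
  refine tendsto_nhds_unique hT ?_
  have : ∀ n, -(∫ z, b n (ρ z.1 z.2) * fderiv ℝ φ z (1, 0) ∂(μ.prod volume))
        - (∫ x, b n (ρ₀ x) * φ (0, x))
        + ∫ z, b n (ρ z.1 z.2) * fderiv ℝ φ z (0, u z.1 z.2) ∂(μ.prod volume) = 0 := fun n => by
    rw [← eq (b n) (hb n) (hA n), hz n]
  simp only [this]
  exact tendsto_const_nhds

end DominatedLimit

/-! ### Jointly measurable representatives and embeddings on bounded sets. -/

section Representatives

variable {N : ℕ} {Ω : Opens (EuclideanSpace ℝ (Fin N))} {T : ℝ}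
  {F : Type*} [NormedAddCommGroup F]

/-- A function in a mixed Lebesgue space has a jointly measurable representative vanishing off the
spatial domain. -/
theorem MemLrLs.exists_representative {r s : ℝ≥0∞} {f : ℝ → EuclideanSpace ℝ (Fin N) → F}
    (hf : MemLrLs Ω T r s f) :
    ∃ g : ℝ → EuclideanSpace ℝ (Fin N) → F, StronglyMeasurable (Function.uncurry g) ∧
      (∀ t, ∀ x ∉ Ω, g t x = 0) ∧
      ∀ᵐ t ∂(volume.restrict (Ioo 0 T)),
        g t =ᵐ[volume.restrict (Ω : Set (EuclideanSpace ℝ (Fin N)))] f t := by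
  have hS : MeasurableSet {z : ℝ × EuclideanSpace ℝ (Fin N) | z.2 ∈ Ω} :=
    Ω.isOpen.measurableSet.preimage measurable_snd
  refine ⟨fun t x => indicator {z : ℝ × EuclideanSpace ℝ (Fin N) | z.2 ∈ Ω} (hf.1.mk _) (t, x),
    hf.1.stronglyMeasurable_mk.indicator hS, fun t x hx =>
      indicator_of_notMem (s := {z : ℝ × EuclideanSpace ℝ (Fin N) | z.2 ∈ Ω}) (a := (t, x)) hx _, ?_⟩
  filter_upwards [Measure.ae_ae_of_ae_prod hf.1.ae_eq_mk] with t ht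
  filter_upwards [ht, ae_restrict_mem Ω.isOpen.measurableSet] with x hx hxΩ
  rw [indicator_of_mem (by exact hxΩ), ← hx]
  rfl

theorem eLpNorm_eq_of_representative {s : ℝ≥0∞} {g f : EuclideanSpace ℝ (Fin N) → F}
    (hg : ∀ x ∉ Ω, g x = 0)
    (hgf : g =ᵐ[volume.restrict (Ω : Set (EuclideanSpace ℝ (Fin N)))] f) :
    eLpNorm g s volume =
      eLpNorm f s (volume.restrict (Ω : Set (EuclideanSpace ℝ (Fin N)))) := by
  rw [← eLpNorm_congr_ae hgf, ← eLpNorm_indicator_eq_eLpNorm_restrict Ω.isOpen.measurableSet]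
  congr 1
  ext x
  by_cases hx : x ∈ Ω
  · rw [indicator_of_mem (by exact hx)]
  · rw [indicator_of_notMem (by exact hx), hg x hx]

variable {E : Type*} [NormedAddCommGroup E] [InnerProductSpace ℝ E] [FiniteDimensional ℝ E]
  [MeasurableSpace E] [BorelSpace E]

theorem measurable_eLpNorm_slice {s : ℝ≥0∞} (hs0 : s ≠ 0) (hs : s ≠ ⊤) {g : ℝ → E → F}
    (hg : StronglyMeasurable (Function.uncurry g)) :
    Measurable fun t => eLpNorm (g t) s volume := by
  simp only [eLpNorm_eq_lintegral_rpow_enorm_toReal hs0 hs]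
  have h : Measurable fun z : ℝ × E => ‖g z.1 z.2‖ₑ ^ s.toReal := hg.enorm.pow_const _
  exact h.lintegral_prod_right'.pow_const _

theorem eLpNorm_one_le_of_bounded_support {s : ℝ≥0∞} (hs : 1 ≤ s) {V : Set E}
    (hV : MeasurableSet V) {g : E → F} (hg : AEStronglyMeasurable g volume)
    (hgV : ∀ x ∉ V, g x = 0) :
    eLpNorm g 1 volume ≤
      eLpNorm g s volume * volume V ^ (1 / (1 : ℝ≥0∞).toReal - 1 / s.toReal) := by
  have hind : V.indicator g = g := by
    ext x
    by_cases hx : x ∈ V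
    · rw [indicator_of_mem hx]
    · rw [indicator_of_notMem hx, hgV x hx]
  have h := eLpNorm_le_eLpNorm_mul_rpow_measure_univ (μ := volume.restrict V) hs hg.restrict
  rwa [← eLpNorm_indicator_eq_eLpNorm_restrict hV, ← eLpNorm_indicator_eq_eLpNorm_restrict hV,
    hind, Measure.restrict_apply_univ] at h

/-- Hölder on a set of finite measure, with a constant independent of `g`, so that it can be applied
on every time slice. The exponent `1 - 1/s` is nonnegative, also for `s = ∞`. -/
theorem exists_eLpNorm_one_le {s : ℝ≥0∞} (hs : 1 ≤ s) {V : Set E} (hV : MeasurableSet V)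
    (hVb : Bornology.IsBounded V) :
    ∃ c : ℝ≥0∞, c ≠ ⊤ ∧ ∀ g : E → F, AEStronglyMeasurable g volume → (∀ x ∉ V, g x = 0) →
      eLpNorm g 1 volume ≤ eLpNorm g s volume * c := by
  refine ⟨volume V ^ (1 / (1 : ℝ≥0∞).toReal - 1 / s.toReal), ?_,
    fun g hg hgV => eLpNorm_one_le_of_bounded_support hs hV hg hgV⟩
  refine ENNReal.rpow_ne_top_of_nonneg ?_ hVb.measure_lt_top.ne
  rcases eq_or_ne s ⊤ with rfl | hs'
  · simp
  · have : 1 ≤ s.toReal := by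
      rw [← ENNReal.toReal_one]
      exact ENNReal.toReal_mono hs' hs
    have := inv_le_one_of_one_le₀ this
    simp only [one_div, ENNReal.toReal_one, inv_one]
    linarith

theorem integrable_prod_of_lintegral_eLpNorm {s : ℝ≥0∞} (hs : 1 ≤ s) {V : Set E}
    (hV : MeasurableSet V) (hVb : Bornology.IsBounded V) {g : ℝ → E → F}
    (hg : StronglyMeasurable (Function.uncurry g)) (hgV : ∀ t, ∀ x ∉ V, g t x = 0)
    (μ : Measure ℝ) (hi : ∫⁻ t, eLpNorm (g t) s volume ∂μ ≠ ⊤) :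
    Integrable (Function.uncurry g) (μ.prod volume) := by
  obtain ⟨c, hc, hcg⟩ := exists_eLpNorm_one_le (F := F) hs hV hVb
  refine ⟨hg.aestronglyMeasurable, ?_⟩
  rw [HasFiniteIntegral, lintegral_prod _ hg.enorm.aemeasurable]
  calc ∫⁻ t, (∫⁻ x, ‖Function.uncurry g (t, x)‖ₑ) ∂μ
      ≤ ∫⁻ t, eLpNorm (g t) s volume * c ∂μ := by
        refine lintegral_mono fun t => ?_
        rw [← eLpNorm_one_eq_lintegral_enorm]
        exact hcg (g t) (hg.comp_measurable
          (measurable_const.prodMk measurable_id)).aestronglyMeasurable (hgV t)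
    _ < ⊤ := by
        rw [lintegral_mul_const' _ _ hc]
        exact (ENNReal.mul_ne_top hi hc).lt_top

end Representatives

/-! ### Transfer between `Ω` and the whole space, and the two implications. -/

section Transfer

variable {N : ℕ} {Ω : Opens (EuclideanSpace ℝ (Fin N))} {T : ℝ}

theorem isTest_testFunction (φ : 𝓓(spaceTime Ω T, ℝ)) : IsTest T (Ω : Set _) φ :=
  ⟨φ.contDiff, φ.hasCompactSupport, φ.tsupport_subset⟩

/-- The weak form depends only on the restriction of the data to `(0,T) × Ω` up to null sets. -/
theorem weakForm_eq_globalForm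
    {u u' : ℝ → EuclideanSpace ℝ (Fin N) → EuclideanSpace ℝ (Fin N)}
    {b₀ b₀' : EuclideanSpace ℝ (Fin N) → ℝ} {b b' : ℝ → EuclideanSpace ℝ (Fin N) → ℝ}
    {φ : ℝ × EuclideanSpace ℝ (Fin N) → ℝ} (hφ : IsTest T (Ω : Set _) φ)
    (hu : ∀ᵐ t ∂(volume.restrict (Ioo 0 T)),
      u' t =ᵐ[volume.restrict (Ω : Set (EuclideanSpace ℝ (Fin N)))] u t)
    (hb₀ : b₀' =ᵐ[volume.restrict (Ω : Set (EuclideanSpace ℝ (Fin N)))] b₀)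
    (hb : ∀ᵐ t ∂(volume.restrict (Ioo 0 T)),
      b' t =ᵐ[volume.restrict (Ω : Set (EuclideanSpace ℝ (Fin N)))] b t) :
    weakForm Ω T u b₀ b φ = globalForm T u' b₀' b' φ := by
  rw [weakForm, globalForm]
  congr 1
  · congr 1
    · congr 1
      refine integral_congr_ae ?_
      filter_upwards [hb] with t ht
      refine Eq.trans (integral_congr_ae ?_)
        (setIntegral_eq_integral_of_forall_compl_eq_zero
          (s := (Ω : Set (EuclideanSpace ℝ (Fin N)))) fun x hx => by
            rw [hφ.fderiv_eq_zero_of_notMem hx t]; simp)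
      filter_upwards [ht] with x hx
      rw [hx, hφ.deriv_time]
    · refine Eq.trans (integral_congr_ae ?_)
        (setIntegral_eq_integral_of_forall_compl_eq_zero
          (s := (Ω : Set (EuclideanSpace ℝ (Fin N)))) fun x hx => by
            rw [hφ.eq_zero_of_notMem hx 0, mul_zero])
      filter_upwards [hb₀] with x hx
      rw [hx]
  · refine integral_congr_ae ?_
    filter_upwards [hb, hu] with t ht htu
    refine Eq.trans (integral_congr_ae ?_)
      (setIntegral_eq_integral_of_forall_compl_eq_zero
        (s := (Ω : Set (EuclideanSpace ℝ (Fin N)))) fun x hx => by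
          rw [hφ.fderiv_eq_zero_of_notMem hx t]; simp)
    filter_upwards [ht, htu] with x hx hxu
    rw [hx, hxu, ← hφ.fderiv_space, inner_gradient_right]
    simp

/-- Jointly measurable global representatives of a velocity and a density. -/
theorem exists_isTransportData (hΩ : Bornology.IsBounded (Ω : Set (EuclideanSpace ℝ (Fin N))))
    {p q : ℝ≥0∞} (hp : 1 ≤ p) (hq1 : 1 ≤ q) (hq : q ≠ ⊤) (hpq : p⁻¹ + q⁻¹ = 1)
    {u : ℝ → EuclideanSpace ℝ (Fin N) → EuclideanSpace ℝ (Fin N)} (hu : MemLrLs Ω T 1 q u)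
    {ρ₀ : EuclideanSpace ℝ (Fin N) → ℝ}
    (hρ₀ : MemLp ρ₀ p (volume.restrict (Ω : Set (EuclideanSpace ℝ (Fin N)))))
    {ρ : ℝ → EuclideanSpace ℝ (Fin N) → ℝ} (hρ : MemLrLs Ω T ∞ p ρ) :
    ∃ u' ρ₀' ρ' M, IsTransportData T u' ρ₀' ρ' ∧ M ≠ ⊤ ∧
      (∀ᵐ t ∂(volume.restrict (Ioo 0 T)),
        MemLp (ρ' t) p volume ∧ eLpNorm (ρ' t) p volume ≤ M) ∧
      MemLp ρ₀' p volume ∧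
      (∀ᵐ t ∂(volume.restrict (Ioo 0 T)), MemLp (u' t) q volume) ∧
      ∫⁻ t in Ioo 0 T, eLpNorm (u' t) q volume ≠ ⊤ ∧
      (∀ᵐ t ∂(volume.restrict (Ioo 0 T)),
        u' t =ᵐ[volume.restrict (Ω : Set (EuclideanSpace ℝ (Fin N)))] u t) ∧
      ρ₀' =ᵐ[volume.restrict (Ω : Set (EuclideanSpace ℝ (Fin N)))] ρ₀ ∧
      ∀ᵐ t ∂(volume.restrict (Ioo 0 T)),
        ρ' t =ᵐ[volume.restrict (Ω : Set (EuclideanSpace ℝ (Fin N)))] ρ t := by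
  have hΩm := Ω.isOpen.measurableSet
  have : ENNReal.HolderConjugate p q := ENNReal.holderConjugate_iff.2 hpq
  obtain ⟨u', hu'm, hu'0, hu'u⟩ := hu.exists_representative
  obtain ⟨ρ', hρ'm, hρ'0, hρ'ρ⟩ := hρ.exists_representative
  set ρ₀' := (Ω : Set (EuclideanSpace ℝ (Fin N))).indicator (hρ₀.1.mk ρ₀) with hρ₀'
  have hρ₀'m : StronglyMeasurable ρ₀' := hρ₀.1.stronglyMeasurable_mk.indicator hΩm
  have hρ₀'0 : ∀ x ∉ Ω, ρ₀' x = 0 := fun x hx => indicator_of_notMem (by exact hx) _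
  have hρ₀'ρ : ρ₀' =ᵐ[volume.restrict (Ω : Set (EuclideanSpace ℝ (Fin N)))] ρ₀ := by
    filter_upwards [hρ₀.1.ae_eq_mk, ae_restrict_mem hΩm] with x hx hxΩ
    rw [hρ₀', indicator_of_mem hxΩ, hx]
  have hut : ∀ t, AEStronglyMeasurable (u' t) volume := fun t =>
    (hu'm.comp_measurable (measurable_const.prodMk measurable_id)).aestronglyMeasurable
  have hρt : ∀ t, AEStronglyMeasurable (ρ' t) volume := fun t =>
    (hρ'm.comp_measurable (measurable_const.prodMk measurable_id)).aestronglyMeasurable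
  have hui : ∫⁻ t in Ioo 0 T, eLpNorm (u' t) q volume ≠ ⊤ := by
    have h := hu.2
    rw [eLpNorm_one_eq_lintegral_enorm] at h
    refine ne_of_eq_of_ne (lintegral_congr_ae ?_) h.ne
    filter_upwards [hu'u] with t ht
    rw [eLpNorm_eq_of_representative (hu'0 t) ht, enorm_eq_self]
  have huq : ∀ᵐ t ∂(volume.restrict (Ioo 0 T)), MemLp (u' t) q volume := by
    have := ae_lt_top (measurable_eLpNorm_slice (by positivity) hq hu'm) hui
    filter_upwards [this] with t ht using ⟨hut t, ht⟩
  set M := eLpNorm (fun t => eLpNorm (ρ t) p (volume.restrict (Ω : Set (EuclideanSpace ℝ (Fin N)))))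
    ∞ (volume.restrict (Ioo 0 T)) with hM
  have hMt : M ≠ ⊤ := hρ.2.ne
  have hρM : ∀ᵐ t ∂(volume.restrict (Ioo 0 T)),
      MemLp (ρ' t) p volume ∧ eLpNorm (ρ' t) p volume ≤ M := by
    have h := ae_le_eLpNormEssSup (f := fun t => eLpNorm (ρ t) p
      (volume.restrict (Ω : Set (EuclideanSpace ℝ (Fin N))))) (μ := volume.restrict (Ioo 0 T))
    filter_upwards [h, hρ'ρ] with t ht htρ
    have h1 : eLpNorm (ρ' t) p volume ≤ M := by
      rw [eLpNorm_eq_of_representative (hρ'0 t) htρ, hM, eLpNorm_exponent_top]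
      simpa using ht
    exact ⟨⟨hρt t, h1.trans_lt hMt.lt_top⟩, h1⟩
  have hρ₀p : MemLp ρ₀' p volume := by
    refine ⟨hρ₀'m.aestronglyMeasurable, ?_⟩
    rw [eLpNorm_eq_of_representative hρ₀'0 hρ₀'ρ]
    exact hρ₀.2
  refine ⟨u', ρ₀', ρ', M, ⟨hu'm, hρ'm, hρ₀'m, ?_, ?_, ?_, ?_⟩, hMt, hρM, hρ₀p, huq, hui, hu'u,
    hρ₀'ρ, hρ'ρ⟩
  · rw [← memLp_one_iff_integrable]
    obtain ⟨c, hc, hcg⟩ := exists_eLpNorm_one_le (F := ℝ) hp hΩm hΩ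
    exact ⟨hρ₀p.1, (hcg ρ₀' hρ₀p.1 hρ₀'0).trans_lt
      (ENNReal.mul_ne_top hρ₀p.eLpNorm_ne_top hc).lt_top⟩
  · exact integrable_prod_of_lintegral_eLpNorm hq1 hΩm hΩ hu'm hu'0 _ hui
  · refine integrable_prod_of_lintegral_eLpNorm hp hΩm hΩ hρ'm hρ'0 _ ?_
    refine ne_top_of_le_ne_top ?_ (lintegral_mono_ae (hρM.mono fun t ht => ht.2))
    rw [lintegral_const]
    exact ENNReal.mul_ne_top hMt (by simp)
  · refine ⟨(hρ'm.smul hu'm).aestronglyMeasurable, ?_⟩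
    have hm : Measurable fun z : ℝ × EuclideanSpace ℝ (Fin N) => ‖ρ' z.1 z.2 • u' z.1 z.2‖ₑ :=
      (hρ'm.smul hu'm).enorm
    rw [HasFiniteIntegral, lintegral_prod _ hm.aemeasurable]
    calc ∫⁻ t in Ioo 0 T, ∫⁻ x, ‖ρ' t x • u' t x‖ₑ
        ≤ ∫⁻ t in Ioo 0 T, M * eLpNorm (u' t) q volume := by
          refine lintegral_mono_ae ?_
          filter_upwards [hρM] with t ht
          rw [← eLpNorm_one_eq_lintegral_enorm]
          refine (eLpNorm_smul_le_mul_eLpNorm (p := p) (q := q) (hut t) (hρt t)).trans ?_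
          gcongr
          exact ht.2
      _ < ⊤ := by
          rw [lintegral_const_mul' _ _ hMt]
          exact (ENNReal.mul_ne_top hMt hui).lt_top

theorem IsRenormalizedSolution.isWeakSolution
    (hΩ : Bornology.IsBounded (Ω : Set (EuclideanSpace ℝ (Fin N))))
    {p q : ℝ≥0∞} (hp : 1 ≤ p) (hq1 : 1 ≤ q) (hq : q ≠ ⊤) (hpq : p⁻¹ + q⁻¹ = 1)
    {u : ℝ → EuclideanSpace ℝ (Fin N) → EuclideanSpace ℝ (Fin N)} (hu : MemLrLs Ω T 1 q u)
    {ρ₀ : EuclideanSpace ℝ (Fin N) → ℝ} {ρ : ℝ → EuclideanSpace ℝ (Fin N) → ℝ}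
    (h : IsRenormalizedSolution Ω T p u ρ₀ ρ) : IsWeakSolution Ω T p u ρ₀ ρ := by
  obtain ⟨hρ₀, hρ, hren⟩ := h
  refine ⟨hρ₀, hρ, fun φ => ?_⟩
  obtain ⟨u', ρ₀', ρ', M, H, -, -, -, -, -, hu', hρ₀', hρ'⟩ :=
    exists_isTransportData hΩ hp hq1 hq hpq hu hρ₀ hρ
  have hφ := isTest_testFunction φ
  rw [weakForm_eq_globalForm hφ hu' hρ₀' hρ']
  -- `A = 0` is allowed since the truncations satisfy `|β_k(s)| ≤ |s|`.
  refine H.globalForm_eq_zero_of_tendsto hφ (β := fun s => s) (A := 0)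
    (fun n => (isAdmissible_arctan n).1.continuous) continuous_id (fun n s => ?_)
    tendsto_mul_arctan_div fun n => ?_
  · have hn : (0 : ℝ) < n + 1 := by positivity
    rw [zero_add, norm_mul, Real.norm_of_nonneg hn.le, Real.norm_eq_abs, Real.norm_eq_abs]
    calc ((n : ℝ) + 1) * |Real.arctan (s / (n + 1))| ≤ (n + 1) * |s / (n + 1)| := by
          exact mul_le_mul_of_nonneg_left (abs_arctan_le_abs _) hn.le
      _ = |s| := by rw [abs_div, abs_of_pos hn]; field_simp
  · rw [← hren _ (isAdmissible_arctan n) φ]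
    exact (weakForm_eq_globalForm hφ hu' (hρ₀'.mono fun x hx => by simp only [hx])
      (hρ'.mono fun t ht => ht.mono fun x hx => by simp only [hx])).symm

theorem IsWeakSolution.isRenormalizedSolution (hT : 0 < T)
    (hΩ : Bornology.IsBounded (Ω : Set (EuclideanSpace ℝ (Fin N))))
    {p q : ℝ≥0∞} (hp : 1 ≤ p) (hq1 : 1 ≤ q) (hq : q ≠ ⊤) (hpq : p⁻¹ + q⁻¹ = 1)
    {u : ℝ → EuclideanSpace ℝ (Fin N) → EuclideanSpace ℝ (Fin N)} (hu : MemLrW1s Ω T 1 q u)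
    (hdiv : IsDivFree Ω T u)
    {ρ₀ : EuclideanSpace ℝ (Fin N) → ℝ} {ρ : ℝ → EuclideanSpace ℝ (Fin N) → ℝ}
    (h : IsWeakSolution Ω T p u ρ₀ ρ) : IsRenormalizedSolution Ω T p u ρ₀ ρ := by
  obtain ⟨hρ₀, hρ, hweak⟩ := h
  obtain ⟨hu, G, hG, hGw⟩ := hu
  refine ⟨hρ₀, hρ, fun β hβ φ => ?_⟩
  obtain ⟨u', ρ₀', ρ', M, H, hM, hρM, hρ₀p, huq, hui, hu', hρ₀', hρ'⟩ :=
    exists_isTransportData hΩ hp hq1 hq hpq hu hρ₀ hρ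
  obtain ⟨G', hG'm, hG'0, hG'G⟩ := hG.exists_representative
  have hΩm := Ω.isOpen.measurableSet
  have hGt : ∀ t, AEStronglyMeasurable (G' t) volume := fun t =>
    (hG'm.comp_measurable (measurable_const.prodMk measurable_id)).aestronglyMeasurable
  have hGi : ∫⁻ t in Ioo 0 T, eLpNorm (G' t) q volume ≠ ⊤ := by
    have h := hG.2
    rw [eLpNorm_one_eq_lintegral_enorm] at h
    refine ne_of_eq_of_ne (lintegral_congr_ae ?_) h.ne
    filter_upwards [hG'G] with t ht
    rw [eLpNorm_eq_of_representative (hG'0 t) ht, enorm_eq_self]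
  have hGq : ∀ᵐ t ∂(volume.restrict (Ioo 0 T)),
      Integrable (G' t) volume ∧ MemLp (G' t) q volume := by
    have := ae_lt_top (measurable_eLpNorm_slice (by positivity) hq hG'm) hGi
    have hint := integrable_prod_of_lintegral_eLpNorm hq1 hΩm hΩ hG'm hG'0 _ hGi
    filter_upwards [this, hint.prod_right_ae] with t ht hti using ⟨hti, hGt t, ht⟩
  have hzero : ∀ {φ : EuclideanSpace ℝ (Fin N) → ℝ}, tsupport φ ⊆ (Ω : Set _) → ∀ x ∉ Ω,
      φ x = 0 ∧ fderiv ℝ φ x = 0 := fun hφ x hx =>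
    ⟨image_eq_zero_of_notMem_tsupport fun h => hx (hφ h),
      image_eq_zero_of_notMem_tsupport fun h => hx (hφ (tsupport_fderiv_subset ℝ h))⟩
  -- The zero extension `G'` need not be a weak derivative of `u'` across the boundary of `Ω`; the
  -- identity is needed only for test functions supported in `Ω`.
  have hw : ∀ᵐ t ∂(volume.restrict (Ioo 0 T)), ∀ φ : EuclideanSpace ℝ (Fin N) → ℝ,
      ContDiff ℝ ∞ φ → HasCompactSupport φ → tsupport φ ⊆ (Ω : Set _) → ∀ y,
      ∫ x, fderiv ℝ φ x y • u' t x = -∫ x, φ x • G' t x y := by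
    filter_upwards [hGw, hu', hG'G] with t ht htu htG φ h1 h2 h3 y
    have e := ht.2.2 ⟨φ, h1, h2, h3⟩ y
    simp only [TestFunction.coe_mk] at e
    have e3 := setIntegral_eq_integral_of_forall_compl_eq_zero (μ := volume)
      (s := (Ω : Set (EuclideanSpace ℝ (Fin N)))) (f := fun x => fderiv ℝ φ x y • u' t x) fun x hx => by
        simp [(hzero h3 x hx).2]
    have e4 := setIntegral_eq_integral_of_forall_compl_eq_zero (μ := volume)
      (s := (Ω : Set (EuclideanSpace ℝ (Fin N)))) (f := fun x => φ x • G' t x y) fun x hx => by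
        simp [(hzero h3 x hx).1]
    have e1 : ∫ x in (Ω : Set (EuclideanSpace ℝ (Fin N))), fderiv ℝ φ x y • u' t x =
        ∫ x in (Ω : Set (EuclideanSpace ℝ (Fin N))), fderiv ℝ φ x y • u t x :=
      integral_congr_ae (htu.mono fun x hx => by simp only [hx])
    have e2 : ∫ x in (Ω : Set (EuclideanSpace ℝ (Fin N))), φ x • G' t x y =
        ∫ x in (Ω : Set (EuclideanSpace ℝ (Fin N))), φ x • G t x y :=
      integral_congr_ae (htG.mono fun x hx => by simp only [hx])
    rw [← e3, ← e4, e1, e2, e]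
  have hd : ∀ᵐ t ∂(volume.restrict (Ioo 0 T)), ∀ φ : EuclideanSpace ℝ (Fin N) → ℝ,
      ContDiff ℝ ∞ φ → HasCompactSupport φ → tsupport φ ⊆ (Ω : Set _) →
      ∫ x, fderiv ℝ φ x (u' t x) = 0 := by
    filter_upwards [hdiv, hu'] with t ht htu φ h1 h2 h3
    have e := ht ⟨φ, h1, h2, h3⟩
    simp only [TestFunction.coe_mk] at e
    have e3 := setIntegral_eq_integral_of_forall_compl_eq_zero (μ := volume)
      (s := (Ω : Set (EuclideanSpace ℝ (Fin N)))) (f := fun x => fderiv ℝ φ x (u' t x)) fun x hx => by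
        simp [(hzero h3 x hx).2]
    rw [← e3, ← e]
    refine integral_congr_ae (htu.mono fun x hx => ?_)
    simp only [hx, inner_gradient_right]
    simp
  have hweak' : ∀ φ, IsTest T (Ω : Set _) φ → globalForm T u' ρ₀' ρ' φ = 0 := fun φ hφ => by
    rw [← weakForm_eq_globalForm hφ hu' hρ₀' hρ']
    exact hweak ⟨φ, hφ.contDiff, hφ.hasCompactSupport, hφ.tsupport_subset⟩
  obtain ⟨hβ1, ⟨A, hA⟩, C, hC⟩ := hβ
  have hK : LipschitzWith C.toNNReal β := by
    refine lipschitzWith_of_nnnorm_deriv_le (hβ1.differentiable (by simp)) fun s => ?_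
    rw [← NNReal.coe_le_coe, coe_nnnorm]
    exact (hC s).trans (Real.le_coe_toNNReal C)
  -- The chain rule argument needs smooth nonlinearities, whereas `β` is only `C^1`; the
  -- approximants keep its sup and Lipschitz bounds.
  obtain ⟨b, hbs, hbA, hbK, hblim⟩ := exists_smooth_approx hA hK
  have hφ := isTest_testFunction φ
  rw [weakForm_eq_globalForm (b₀' := fun x => β (ρ₀' x)) (b' := fun t x => β (ρ' t x)) hφ hu'
    (hρ₀'.mono fun x hx => by simp only [hx])
    (hρ'.mono fun t ht => ht.mono fun x hx => by simp only [hx])]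
  refine H.globalForm_eq_zero_of_tendsto hφ (A := A) (fun n => (hbs n).continuous)
    hβ1.continuous (fun n s => (hbA n s).trans (le_add_of_nonneg_right (norm_nonneg s))) hblim
    fun n => ?_
  exact H.globalForm_renormalized hT hpq hq hM hρM hρ₀p huq hui Ω.isOpen hG'm hGq hGi hw hd
    hweak' hφ (hbs n) (hbA n) (hbK n)

end Transfer

end Transport

theorem mainTheorem5 (N : ℕ) (hN : 1 ≤ N)
    (Ω : Opens (EuclideanSpace ℝ (Fin N)))
    (hΩ : Bornology.IsBounded (Ω : Set (EuclideanSpace ℝ (Fin N))))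
    (T : ℝ) (hT : 0 < T)
    (p q : ℝ≥0∞) (hp : 1 < p) (hpq : p⁻¹ + q⁻¹ = 1)
    (u : ℝ → EuclideanSpace ℝ (Fin N) → EuclideanSpace ℝ (Fin N))
    (hu : Transport.MemLrLs Ω T 1 q u)
    (ρ₀ : EuclideanSpace ℝ (Fin N) → ℝ)
    (ρ : ℝ → EuclideanSpace ℝ (Fin N) → ℝ) :
    (Transport.IsRenormalizedSolution Ω T p u ρ₀ ρ → Transport.IsWeakSolution Ω T p u ρ₀ ρ) ∧
      (Transport.MemLrW1s Ω T 1 q u → Transport.IsDivFree Ω T u →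
        Transport.IsWeakSolution Ω T p u ρ₀ ρ →
          Transport.IsRenormalizedSolution Ω T p u ρ₀ ρ) := by
  have hq1 : 1 ≤ q := by
    rw [← ENNReal.inv_le_one, ← hpq]
    exact le_add_self
  -- Here `p > 1` is used: it makes `q` finite, on which continuity of translations in `L^q` rests.
  have hq : q ≠ ⊤ := by
    rintro rfl
    rw [ENNReal.inv_top, add_zero, ENNReal.inv_eq_one] at hpq
    exact hp.ne' hpq
  exact ⟨fun h => h.isWeakSolution hΩ hp.le hq1 hq hpq hu,
    fun hW hdiv h => h.isRenormalizedSolution hT hΩ hp.le hq1 hq hpq hW hdiv⟩
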